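/- **Trees.** A tree is a partially ordered set $(T,\preceq)$ in which every set $\{b: b\prec a\}$ is finite and linearly ordered; $\ell(a)=|\{b:b\prec a\}|$ is the level of $a$, $T(n)$ is the set of nodes of level $n$, and $T({<}n)$, $T({\le}n)$ are defined accordingly. An $\mathcal S$-tree is a countable finitely branching tree with finitely many nodes of level $0$, together with a set $\Sigma$ and a partial function $\mathcal S\colon T\times T^{<\omega}\times\Sigma\to T$ such that: if $\mathcal S(a,\bar p,c)$ is defined, then it is an immediate successor of $a$ and all entries of $\bar p$ have level $<\ell(a)$; $\mathcal S(a,\bar p,c)=\mathcal S(b,\bar q,d)$ implies $a=b$, $\bar p=\bar q$, $c=d$; every immediate successor of a node $a$ is of the form $\mathcal S(a,\bar p,c)$. An injection $F\colon T\to T$ is shape-preserving if nodes of equal level have images of equal level, $\mathcal S(F(a),F(\bar p),c)$ is defined and $\preceq F(\mathcal S(a,\bar p,c))$ whenever $\mathcal S(a,\bar p,c)$ is defined, and $a\preceq F(b)$ whenever $a\in T(0)$ and $a\preceq b$. Write $\tilde F(n)$ for the level of $F(a)$, $a\in T(n)$. $F$ skips level $m$ if $m\notin\tilde F[\omega]$,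 and skips only level $m$ if $\tilde F[\omega]=\omega\setminus\{m\}$. An $(\mathcal S,\mathcal M)$-tree is an $\mathcal S$-tree with a set $\mathcal M$ of shape-preserving functions such that 1. $\mathrm{Id}\in\mathcal M$, $\mathcal M$ is closed under composition, and whenever $F_i\in\mathcal M$ and $F_i\restriction_{T(\le i)}=F_{i+1}\restriction_{T(\le i)}$ for all $i\in\omega$, there is $F_\infty\in\mathcal M$ with $F_\infty\restriction_{T(\le i)}=F_i\restriction_{T(\le i)}$ for all $i$; 2. if $F\in\mathcal M$, $\tilde F(n)>0$ and $F$ skips level $\tilde F(n)-1$, then there are $F_1,F_2\in\mathcal M$ such that $F_2$ skips only level $\tilde F(n)-1$ and $F_2\circ F_1\restriction_{T(\le n)}=F\restriction_{T(\le n)}$; 3. for all $n<m$ there is $F\in\mathcal M$ skipping only level $m$ such that $F(b)=\mathcal S(b,\bar p,c)$ whenever $a\in T(n)$, $b\in T(m)$, and $\mathcal S(a,\bar p,c)$ is defined and $\preceq b$. Let $\mathcal{AM}^n_1(m)$ be the set of restrictions $f=F\restriction_{T(\le n)}$ of functions $F\in\mathcal M$ that are the identity on $T({<}n)$ and satisfy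 $\tilde F(n)=m$. Each such $f$ has a unique canonical extension $f^+\in\mathcal M$: it extends $f$ and skips no level $\ge m$. **Fat subtrees.** A fat subtree of height $n\in\omega+1$ is a sequence $\mathbf U=(u_i)_{i<n}$ for which there is a (necessarily unique) cut function $c_{\mathbf U}\colon\min(n+1,\omega)\to\omega$ with $c_{\mathbf U}(0)=0$ and $u_\ell\in\mathcal{AM}^{c_{\mathbf U}(\ell)}_1(c_{\mathbf U}(\ell+1)-1)$ for all $\ell<n$. For $X\subseteq T(c_{\mathbf U}(\ell))$ and $\ell\le k\le n$ let $\mathrm{lift}_{\mathbf U}(X,\ell,k)=X$ if $\ell=k$, and otherwise $\mathrm{lift}_{\mathbf U}(X,\ell,k)=\mathrm{lift}_{\mathbf U}(u_\ell^+[N],\ell+1,k)$, where $N$ is the set of immediate successors of nodes in $X$. Put $\mathrm{lift}_{\mathbf U}(\ell,k)=\mathrm{lift}_{\mathbf U}(T(c_{\mathbf U}(\ell)),\ell,k)$. For fat subtrees $\mathbf V,\mathbf U$ of heights $m,m'$ write $\mathbf V\le\mathbf U$ if there is $\varphi\colon\min(m+1,\omega)\to\min(m'+1,\omega)$ such that for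 every $\ell<m$ we have $c_{\mathbf V}(\ell)=c_{\mathbf U}(\varphi(\ell))$, $\varphi(\ell)\le\varphi(\ell+1)$ and $\mathrm{lift}_{\mathbf V}(\ell,\ell+1)\subseteq\mathrm{lift}_{\mathbf U}(\varphi(\ell),\varphi(\ell+1))$. Let $\mathcal R$ be the set of infinite fat subtrees (height $\omega$), with the Ellentuck topology generated by the sets $$[\mathbf x,\mathbf U]=\{\mathbf V\in\mathcal R:\mathbf V\le\mathbf U\text{ and }\mathbf x\text{ is an initial segment of }\mathbf V\}$$ for $\mathbf x$ a finite fat subtree and $\mathbf U\in\mathcal R$. Write $[n,\mathbf U]=[\mathbf U\restriction_n,\mathbf U]$. If $\mathbf x\le\mathbf U$, let $\mathrm{depth}_{\mathbf U}(\mathbf x)$ be the unique $n$ with $c_{\mathbf U}(n)=c_{\mathbf x}(|\mathbf x|)$; otherwise let it be $\omega$. A set $\mathcal X\subseteq\mathcal R$ is *Ramsey* if for every $[\mathbf x,\mathbf U]\ne\emptyset$ the depth of $\mathbf x$ in $\mathbf U$ is finite and there is $\mathbf U'\in[\mathrm{depth}_{\mathbf U}(\mathbf x),\mathbf U]$ with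 $[\mathbf x,\mathbf U']\subseteq\mathcal X$ or $[\mathbf x,\mathbf U']\cap\mathcal X=\emptyset$; it is *Ramsey null* if the second alternative can always be achieved. **Theorem 1.10 (Ellentuck theorem for fat subtrees).** Let $(T,\preceq,\Sigma,\mathcal S,\mathcal M)$ be an $(\mathcal S,\mathcal M)$-tree and let $\mathcal R$ be its space of infinite fat subtrees with the Ellentuck topology. Then every subset of $\mathcal R$ with the property of Baire (a symmetric difference of an open set and a meager set) is Ramsey, and every meager subset of $\mathcal R$ is Ramsey null. -/

import Mathlib

/-- The level of a node: the number of its strict predecessors. -/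
noncomputable def nodeLevel {T : Type*} [PartialOrder T] (a : T) : ℕ := (Set.Iio a).ncard

/-- An `S`-tree on the partially ordered set `T` with alphabet `A`. The partial successor operation
is `succOp`; the value `none` means that it is undefined. -/
structure STree (T A : Type*) [PartialOrder T] where
  finite_below : ∀ a : T, (Set.Iio a).Finite
  chain_below : ∀ a : T, IsChain (· ≤ ·) (Set.Iio a)
  countable_nodes : Countable T
  finite_branching : ∀ a : T, {b : T | a ⋖ b}.Finite
  finite_roots : {a : T | nodeLevel a = 0}.Finite
  succOp : T → List T → A → Option T
  succ_spec : ∀ a p c b, succOp a p c = some b → a ⋖ b ∧ ∀ q ∈ p, nodeLevel q < nodeLevel a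
  succ_inj : ∀ a p c b q d x, succOp a p c = some x → succOp b q d = some x →
    a = b ∧ p = q ∧ c = d
  succ_constr : ∀ a b, a ⋖ b → ∃ p c, succOp a p c = some b

/-- Shape-preserving functions `T → T` of an `S`-tree. -/
structure STree.IsShapePreserving {T A : Type*} [PartialOrder T] (τ : STree T A) (F : T → T) :
    Prop where
  injective : Function.Injective F
  level_preserving : ∀ a b, nodeLevel a = nodeLevel b → nodeLevel (F a) = nodeLevel (F b)
  weakly_succ_preserving : ∀ a p c b, τ.succOp a p c = some b →
    ∃ d, τ.succOp (F a) (p.map F) c = some d ∧ d ≤ F b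
  root_le : ∀ a b, nodeLevel a = 0 → a ≤ b → a ≤ F b

/-- `F` skips level `m`. -/
def SkipsLevel {T : Type*} [PartialOrder T] (F : T → T) (m : ℕ) : Prop :=
  m ∉ Set.range (fun a => nodeLevel (F a))

/-- `F` skips only level `m`: the set of levels met by its range is `ω \ {m}`. -/
def SkipsOnlyLevel {T : Type*} [PartialOrder T] (F : T → T) (m : ℕ) : Prop :=
  Set.range (fun a => nodeLevel (F a)) = {m}ᶜ

/-- An `(S, M)`-tree: an `S`-tree with a closed monoid `M` of shape-preserving functions which
admits decompositions and is closed for duplication. -/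
structure SMTree (T A : Type*) [PartialOrder T] extends STree T A where
  M : Set (T → T)
  shape_preserving : ∀ F ∈ M, toSTree.IsShapePreserving F
  id_mem : id ∈ M
  comp_mem : ∀ F ∈ M, ∀ G ∈ M, F ∘ G ∈ M
  limit_mem : ∀ F : ℕ → T → T, (∀ i, F i ∈ M) →
    (∀ i a, nodeLevel a ≤ i → F i a = F (i + 1) a) →
    ∃ G ∈ M, ∀ i a, nodeLevel a ≤ i → G a = F i a
  /-- Here `m + 1` is the common level of the images of the nodes of level `n`. -/
  decomposition : ∀ F ∈ M, ∀ n m : ℕ, (∃ a, nodeLevel a = n ∧ nodeLevel (F a) = m + 1) →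
    SkipsLevel F m →
    ∃ F₁ ∈ M, ∃ F₂ ∈ M, SkipsOnlyLevel F₂ m ∧ ∀ a, nodeLevel a ≤ n → F₂ (F₁ a) = F a
  duplication : ∀ n m : ℕ, n < m → ∃ F ∈ M, SkipsOnlyLevel F m ∧
    ∀ a b p c d, nodeLevel a = n → nodeLevel b = m → succOp a p c = some d → d ≤ b →
      succOp b p c = some (F b)

/-- The restriction of `F` to the nodes of level `< k`, as a partial function. -/
noncomputable def restrictBelow {T : Type*} [PartialOrder T] (F : T → T) (k : ℕ) : T → Option T :=
  fun a => if nodeLevel a < k then some (F a) else none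

namespace SMTree

variable {T A : Type*} [PartialOrder T]

/-- `M^n`: the functions in `M` that are the identity on the nodes of level `< n`. -/
def MFix (τ : SMTree T A) (n : ℕ) : Set (T → T) :=
  {F | F ∈ τ.M ∧ ∀ a, nodeLevel a < n → F a = a}

/-- `AM^n_k`: the restrictions to the levels `< n + k` of the functions in `M^n`. -/
def AMApprox (τ : SMTree T A) (n k : ℕ) : Set (T → Option T) :=
  {f | ∃ F ∈ τ.MFix n, f = restrictBelow F (n + k)}

/-- `AM^n_k(m)`: the members of `AM^n_k` that send level `n + k - 1` to level `m`. -/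
def AMApproxTo (τ : SMTree T A) (n k m : ℕ) : Set (T → Option T) :=
  {f | f ∈ τ.AMApprox n k ∧ ∃ a b, nodeLevel a + 1 = n + k ∧ f a = some b ∧ nodeLevel b = m}

/-- `G` is the canonical extension of the partial function `f` with domain the levels `≤ n`:
it lies in `M`, extends `f`, and skips no level from the image of level `n` on. -/
def IsCanonicalExtension (τ : SMTree T A) (f : T → Option T) (n : ℕ) (G : T → T) : Prop :=
  G ∈ τ.M ∧ restrictBelow G (n + 1) = f ∧
    ∀ a k, nodeLevel a = n → nodeLevel (G a) ≤ k → ∃ b, nodeLevel (G b) = k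

open Classical in
/-- The canonical extension `f⁺` (the last case never occurs for members of `AM`). -/
noncomputable def canonicalExtension (τ : SMTree T A) (f : T → Option T) (n : ℕ) : T → T :=
  if h : ∃ G, τ.IsCanonicalExtension f n G then h.choose else id

/-- `c` is a cut function of the sequence `u` of length `n`. -/
def IsCut (τ : SMTree T A) (n : ℕ∞) (u : ℕ → T → Option T) (c : ℕ → ℕ) : Prop :=
  c 0 = 0 ∧ ∀ i : ℕ, (i : ℕ∞) < n → ∃ m, c (i + 1) = m + 1 ∧ u i ∈ τ.AMApproxTo (c i) 1 m

/-- A fat subtree of height `n ∈ ω + 1`, i.e. a sequence of length `n` of partial functions which has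
a cut function. The sequence is padded by the empty partial function from index `n` on. -/
@[ext]
structure FatSubtree (τ : SMTree T A) (n : ℕ∞) where
  seq : ℕ → T → Option T
  seq_padding : ∀ i : ℕ, n ≤ (i : ℕ∞) → seq i = fun _ => none
  exists_cut : ∃ c, τ.IsCut n seq c

/-- The values of a cut function up to index `n` are unique. -/
theorem IsCut.unique {τ : SMTree T A} {n : ℕ∞} {u : ℕ → T → Option T} {c c' : ℕ → ℕ}
    (h : τ.IsCut n u c) (h' : τ.IsCut n u c') : ∀ i : ℕ, (i : ℕ∞) ≤ n → c i = c' i := by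
  intro i
  induction i with
  | zero => intro _; rw [h.1, h'.1]
  | succ i ih =>
    intro hi
    have hlt : (i : ℕ∞) < n := lt_of_lt_of_le (by exact_mod_cast Nat.lt_succ_self i) hi
    obtain ⟨m, hm, ⟨F, hF, hu⟩, a, b, ha, hab, hb⟩ := h.2 i hlt
    obtain ⟨m', hm', -, a', b', ha', hab', hb'⟩ := h'.2 i hlt
    have hc := ih hlt.le
    rw [hu] at hab hab'
    have e : F a = b := by
      unfold restrictBelow at hab; split_ifs at hab; exact Option.some.inj hab
    have e' : F a' = b' := by
      unfold restrictBelow at hab'; split_ifs at hab'; exact Option.some.inj hab'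
    have := (τ.shape_preserving F hF.1).level_preserving a a' (by omega)
    rw [e, e'] at this
    omega

namespace FatSubtree

variable {τ : SMTree T A}

/-- The cut function of a fat subtree of height `n` (used at indices `≤ n` only). -/
noncomputable def cut {n : ℕ∞} (U : τ.FatSubtree n) : ℕ → ℕ := U.exists_cut.choose

/-- The recursion defining lifts: lift a set of nodes of level `cut ℓ` by `j` levels of `U`. -/
noncomputable def liftSteps {n : ℕ∞} (U : τ.FatSubtree n) : ℕ → ℕ → Set T → Set T
  | 0, _, X => X
  | j + 1, ℓ, X =>
    U.liftSteps j (ℓ + 1) (τ.canonicalExtension (U.seq ℓ) (U.cut ℓ) '' {b | ∃ a ∈ X, a ⋖ b})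

/-- The lift to level `k` of the set of all nodes of level `cut ℓ`, for `ℓ ≤ k ≤ n`. -/
noncomputable def lift {n : ℕ∞} (U : τ.FatSubtree n) (ℓ k : ℕ) : Set T :=
  U.liftSteps (k - ℓ) ℓ {a | nodeLevel a = U.cut ℓ}

/-- The relation "`V` is a subtree of `U`" between fat subtrees of heights `m` and `m'`. The
inequality `φ ℓ ≤ φ (ℓ + 1)` says that the lift on the right-hand side is defined. -/
def IsSubtree {m m' : ℕ∞} (V : τ.FatSubtree m) (U : τ.FatSubtree m') : Prop :=
  ∃ φ : ℕ → ℕ, (∀ ℓ : ℕ, (ℓ : ℕ∞) ≤ m → (φ ℓ : ℕ∞) ≤ m') ∧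
    ∀ ℓ : ℕ, (ℓ : ℕ∞) < m →
      V.cut ℓ = U.cut (φ ℓ) ∧ φ ℓ ≤ φ (ℓ + 1) ∧ V.lift ℓ (ℓ + 1) ⊆ U.lift (φ ℓ) (φ (ℓ + 1))

/-- The restriction of an infinite fat subtree to its first `n` members. -/
noncomputable def truncate (U : τ.FatSubtree ⊤) (n : ℕ) : τ.FatSubtree n where
  seq i := if i < n then U.seq i else fun _ => none
  seq_padding i hi := if_neg (not_lt.mpr (by exact_mod_cast hi))
  exists_cut := by
    obtain ⟨c, h0, h⟩ := U.exists_cut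
    refine ⟨c, h0, fun i hi => ?_⟩
    have hn : i < n := by exact_mod_cast hi
    simpa only [hn, if_true] using h i (ENat.natCast_lt_top i)

/-- The basic open set `[x, U]`: the infinite fat subtrees of `U` with initial segment `x`. -/
def basic {k : ℕ} (x : τ.FatSubtree k) (U : τ.FatSubtree ⊤) : Set (τ.FatSubtree ⊤) :=
  {V | V.IsSubtree U ∧ ∀ i < k, V.seq i = x.seq i}

/-- The Ellentuck topology on the space of infinite fat subtrees. -/
instance ellentuckTopology : TopologicalSpace (τ.FatSubtree ⊤) :=
  TopologicalSpace.generateFrom {s | ∃ (k : ℕ) (x : τ.FatSubtree k) (U : τ.FatSubtree ⊤),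
    s = basic x U}

/-- The depth of `x` in `U`: the unique `n` with `U.cut n = x.cut k` if `x` is a subtree of `U`,
and `⊤` otherwise (the infimum of the empty set). -/
noncomputable def depth {k : ℕ} (U : τ.FatSubtree ⊤) (x : τ.FatSubtree k) : ℕ∞ :=
  sInf {d | x.IsSubtree U ∧ ∃ n : ℕ, d = n ∧ U.cut n = x.cut k}

/-- Ramsey sets of infinite fat subtrees. -/
def IsRamsey (X : Set (τ.FatSubtree ⊤)) : Prop :=
  ∀ (k : ℕ) (x : τ.FatSubtree k) (U : τ.FatSubtree ⊤), (basic x U).Nonempty →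
    ∃ n : ℕ, depth U x = n ∧ ∃ U' ∈ basic (U.truncate n) U,
      basic x U' ⊆ X ∨ basic x U' ∩ X = ∅

/-- Ramsey null sets of infinite fat subtrees. -/
def IsRamseyNull (X : Set (τ.FatSubtree ⊤)) : Prop :=
  ∀ (k : ℕ) (x : τ.FatSubtree k) (U : τ.FatSubtree ⊤), (basic x U).Nonempty →
    ∃ n : ℕ, depth U x = n ∧ ∃ U' ∈ basic (U.truncate n) U, basic x U' ∩ X = ∅

end FatSubtree

end SMTree

/-- The property of Baire: being the symmetric difference of an open set and a meager set. -/
def HasBaireProperty {X : Type*} [TopologicalSpace X] (s : Set X) : Prop :=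
  ∃ O N : Set X, IsOpen O ∧ IsMeagre N ∧ s = symmDiff O N

/-!
Regard the maps `u ℓ` of a fat subtree as edges from `c ℓ` to `c (ℓ + 1)`: fat subtrees are paths,
and `V ≤ U` says that every edge of `V` is spanned by a segment of `U`. For infinite paths the
theorem follows by combinatorial forcing and fusion, as in the proofs of Galvin–Prikry and
Ellentuck, from a pigeonhole principle: given a set of edges, a path can be thinned out beyond a
given index so that the edges leaving that index all belong to the set or all avoid it.

For the pigeonhole principle, first thin out the path so that each of its edges is rich: as many
simultaneous choices of successors as possible occur below its top. Then whatever a subtree does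
at a cut is a copy of what happens at an earlier level, and the maps along the lifts are encoded
by words whose letters are levels. A duplication of the level below the cut behaves like a
variable: copying from it later amounts to copying from the level that was put there. So an
ultrafilter argument for variable words, as in the Hales–Jewett theorem, yields maps of one colour
that can be continued in every required way, and these are assembled into the edges of a
homogeneous subtree.
-/

/-! ### Variable words -/

section VariableWords

open Filter

attribute [local instance] Ultrafilter.semigroup

theorem continuous_ultrafilterMap {X Y : Type*} (m : X → Y) :
    Continuous (Ultrafilter.map m) := by
  refine ultrafilterBasis_is_basis.continuous_iff.2 ?_
  rintro _ ⟨s, rfl⟩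
  exact ultrafilter_isOpen_basic (m ⁻¹' s)

theorem ultrafilterMap_mul {M N : Type*} [Semigroup M] [Semigroup N] (φ : M →ₙ* N)
    (q q' : Ultrafilter M) : (q * q').map φ = q.map φ * q'.map φ := by
  ext B
  have h : (∀ᶠ n in (q.map φ * q'.map φ : Ultrafilter N), n ∈ B) ↔
      ∀ᶠ v in q, ∀ᶠ v' in q', φ v * φ v' ∈ B := Ultrafilter.eventually_mul _ _ _
  simp only [← map_mul, ← Ultrafilter.eventually_mul q q' (φ · ∈ B)] at h
  exact h.symm

theorem eventually_recurrent_of_mul_self {M : Type*} [Semigroup M] {p : Ultrafilter M}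
    (hp : p * p = p) {B : Set M} (hB : ∀ᶠ s in p, s ∈ B) :
    ∀ᶠ s in p, s ∈ B ∧ ∀ᶠ t in p, ∀ᶠ u in p, s * t * u ∈ B := by
  have eventually_mul {C : Set M} (hC : ∀ᶠ s in p, s ∈ C) : ∀ᶠ s in p, ∀ᶠ t in p, s * t ∈ C := by
    rw [← hp] at hC
    exact (Ultrafilter.eventually_mul p p (· ∈ C)).1 hC
  exact hB.and (eventually_mul (C := {s | ∀ᶠ u in p, s * u ∈ B}) (eventually_mul hB))

variable {α : Type*}

/-- Substitution of the letter `f` for the variable `none` in a variable word. -/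
def substWord (f : α) : FreeMonoid (Option α) →* FreeMonoid α :=
  FreeMonoid.map (·.getD f)

theorem toList_substWord (f : α) (v : FreeMonoid (Option α)) :
    (substWord f v).toList = v.toList.map (·.getD f) :=
  FreeMonoid.toList_map _ _

theorem exists_variableWord_mono {κ : Type*} [Finite κ] (S : Finset α) (C : FreeMonoid α → κ) :
    ∃ v : FreeMonoid (Option α), none ∈ v.toList ∧
      ∃ c, ∀ f ∈ S, C (substWord f v) = c := by
  obtain ⟨ι, _, h⟩ := Combinatorics.Line.exists_mono_in_high_dimension S κ
  let coords := (Finset.univ : Finset ι).toList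
  obtain ⟨l, c, hl⟩ := h fun x => C (.ofList (coords.map fun i => (x i : α)))
  refine ⟨.ofList (coords.map fun i => (l.idxFun i).map (↑)), ?_, c, fun f hf => ?_⟩
  · obtain ⟨i, hi⟩ := l.proper
    exact List.mem_map.2 ⟨i, by simp [coords], by simp [hi]⟩
  · rw [← hl ⟨f, hf⟩]
    congr 1
    refine (toList_substWord _ _).trans ((List.map_map ..).trans ?_)
    refine List.map_congr_left fun i _ => ?_
    simp only [Function.comp_apply, Combinatorics.Line.apply_def]
    cases l.idxFun i <;> rfl

variable (α) in
/-- The ultrafilters that concentrate on the words containing the variable and whose image under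
the substitution of a letter does not depend on the letter. -/
def lineUltrafilters : Set (Ultrafilter (FreeMonoid (Option α))) :=
  {q | (∀ᶠ v : FreeMonoid (Option α) in q, none ∈ v.toList) ∧
    ∀ f f' : α, q.map (substWord f) = q.map (substWord f')}

theorem lineUltrafilters_nonempty : (lineUltrafilters α).Nonempty := by
  classical
  have line (I : Finset (Set (FreeMonoid α) × α × α)) : ∃ v : FreeMonoid (Option α),
      none ∈ v.toList ∧ ∀ x ∈ I, substWord x.2.1 v ∈ x.1 → substWord x.2.2 v ∈ x.1 := by
    obtain ⟨v, hv, c, hc⟩ := exists_variableWord_mono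
      (I.image (·.2.1) ∪ I.image (·.2.2)) fun w (x : I) => decide (w ∈ x.1.1)
    refine ⟨v, hv, fun x hx h => ?_⟩
    have h₁ := congrFun (hc x.2.1 (Finset.mem_union_left _ (Finset.mem_image_of_mem _ hx))) ⟨x, hx⟩
    have h₂ := congrFun (hc x.2.2 (Finset.mem_union_right _ (Finset.mem_image_of_mem _ hx))) ⟨x, hx⟩
    exact decide_eq_true_iff.1 ((h₂.trans h₁.symm).trans (decide_eq_true h))
  choose v hv hmono using line
  have eventually_of {P : FreeMonoid (Option α) → Prop} (h : ∀ᶠ I in atTop, P (v I)) :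
      ∀ᶠ w in Ultrafilter.of (map v atTop), P w := Ultrafilter.of_le (map v atTop) h
  refine ⟨.of (map v atTop), eventually_of (.of_forall hv), fun f f' => Ultrafilter.eq_of_le ?_⟩
  intro B (hB : ∀ᶠ w in Ultrafilter.of (map v atTop), substWord f' w ∈ B)
  have hmem : ∀ᶠ w in Ultrafilter.of (map v atTop), substWord f' w ∈ B → substWord f w ∈ B :=
    eventually_of ((eventually_ge_atTop {(B, f', f)}).mono fun I hI =>
      hmono I _ (hI (Finset.mem_singleton_self _)))
  exact hmem.mp (hB.mono fun _ h h' => h' h)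

theorem lineUltrafilters_isClosed : IsClosed (lineUltrafilters α) := by
  have : lineUltrafilters α = {q | {v : FreeMonoid (Option α) | none ∈ v.toList} ∈ q} ∩
      ⋂ (f : α) (f' : α), {q | q.map (substWord f) = q.map (substWord f')} := by
    ext q
    simp only [Set.mem_inter_iff, Set.mem_iInter]
    rfl
  rw [this]
  exact (ultrafilter_isClosed_basic _).inter (isClosed_iInter fun f => isClosed_iInter fun f' =>
    isClosed_eq (continuous_ultrafilterMap _) (continuous_ultrafilterMap _))

theorem map_substWord_mul (f : α) (q q' : Ultrafilter (FreeMonoid (Option α))) :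
    (q * q').map (substWord f) = q.map (substWord f) * q'.map (substWord f) :=
  ultrafilterMap_mul (substWord f : FreeMonoid (Option α) →ₙ* FreeMonoid α) q q'

theorem mul_mem_lineUltrafilters {q q' : Ultrafilter (FreeMonoid (Option α))}
    (hq : q ∈ lineUltrafilters α) (hq' : q' ∈ lineUltrafilters α) :
    q * q' ∈ lineUltrafilters α := by
  refine ⟨(Ultrafilter.eventually_mul _ _ _).2 ?_, fun f f' => ?_⟩
  · filter_upwards [hq.1] with v hv
    exact .of_forall fun v' => by
      rw [FreeMonoid.toList_mul]
      exact List.mem_append_left _ hv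
  · rw [map_substWord_mul, map_substWord_mul, hq.2 f f', hq'.2 f f']

theorem exists_idempotent_lineUltrafilter :
    ∃ q : Ultrafilter (FreeMonoid (Option α)), q ∈ lineUltrafilters α ∧ q * q = q :=
  exists_idempotent_in_compact_subsemigroup Ultrafilter.continuous_mul_left _
    lineUltrafilters_nonempty lineUltrafilters_isClosed.isCompact
    fun _ hp _ hq => mul_mem_lineUltrafilters hp hq

/-- The part of a variable word before the first occurrence of the variable. -/
def constPrefix : List (Option α) → List α
  | [] => []
  | none :: _ => []
  | some a :: v => a :: constPrefix v

theorem exists_eq_constPrefix_append {v : List (Option α)} (hv : none ∈ v) :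
    ∃ z, v = (constPrefix v).map some ++ none :: z := by
  induction v with
  | nil => simp at hv
  | cons o v ih =>
    cases o with
    | none => exact ⟨v, rfl⟩
    | some a =>
      obtain ⟨z, hz⟩ := ih (by simpa using hv)
      exact ⟨z, by simpa [constPrefix] using hz⟩

theorem exists_recurrent_variableWord [Nonempty α] {p : Ultrafilter (FreeMonoid α)}
    {q : Ultrafilter (FreeMonoid (Option α))}
    (hq : ∀ᶠ v : FreeMonoid (Option α) in q, none ∈ v.toList)
    (hpp : p * p = p) (hp : ∀ f, q.map (substWord f) = p) {I : Type*} {W : Set I} (hW : W.Finite)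
    {P : I → FreeMonoid α → FreeMonoid (Option α) → Prop}
    (hP : ∀ w ∈ W, ∀ᶠ s in p, ∀ᶠ v in q, P w s v) (S : Finset α) :
    ∃ (s : FreeMonoid α) (v : FreeMonoid (Option α)), s ≠ 1 ∧ none ∈ v.toList ∧
      ∀ w ∈ W, P w s v ∧ ∀ f ∈ S, ∀ᶠ u in p, ∀ᶠ v' in q, P w (s * substWord f v * u) v' := by
  have eventually_substWord (f : α) {Q : FreeMonoid α → Prop} (h : ∀ᶠ t in p, Q t) :
      ∀ᶠ v in q, Q (substWord f v) := by
    rw [← hp f] at h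
    exact h
  have hrec : ∀ᶠ s in p, ∀ w ∈ W, (∀ᶠ v in q, P w s v) ∧
      ∀ᶠ t in p, ∀ᶠ u in p, ∀ᶠ v in q, P w (s * t * u) v :=
    (eventually_all_finite hW).2 fun w hw =>
      eventually_recurrent_of_mul_self (B := {s | ∀ᶠ v in q, P w s v}) hpp (hP w hw)
  have hne : ∀ᶠ s : FreeMonoid α in p, s ≠ 1 := by
    rw [← hp (Classical.arbitrary α)]
    exact hq.mono fun v hv h => List.ne_nil_of_mem hv
      (List.map_eq_nil_iff.1 ((toList_substWord _ v).symm.trans (congrArg FreeMonoid.toList h)))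
  obtain ⟨s, hs₁, hs⟩ := (hne.and hrec).exists
  have hline : ∀ᶠ v in q, ∀ w ∈ W, ∀ f ∈ S,
      ∀ᶠ u in p, ∀ᶠ v' in q, P w (s * substWord f v * u) v' :=
    (eventually_all_finite hW).2 fun w hw => (eventually_all_finset S).2 fun f _ =>
      eventually_substWord f (hs w hw).2
  have hs' : ∀ᶠ v in q, ∀ w ∈ W, P w s v := (eventually_all_finite hW).2 fun w hw => (hs w hw).1
  obtain ⟨v, hv, hPv, hGv⟩ := (hq.and (hs'.and hline)).exists
  exact ⟨s, v, hs₁, hv, fun w hw => ⟨hPv w hw, hGv w hw⟩⟩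

/-- From any finite set of states in `G`, a common word `t` leads into `E`, and `t` has a common
continuation by a word in one variable all of whose relevant instances lead back into `G`. The
variable is the letter that follows `t` and the entries `none` of `z`. -/
def IsRecurrent {Z : Type*} (act : Z → α → Z) (G E : Set Z) : Prop :=
  ∀ W : Set Z, W.Finite → W ⊆ G → ∀ S : Finset α, ∃ (t : List α) (z : List (Option α)), t ≠ [] ∧
    ∀ w ∈ W, t.foldl act w ∈ E ∧ ∀ f ∈ S, (t ++ f :: z.map (·.getD f)).foldl act w ∈ G

theorem exists_isRecurrent [Nonempty α] {Z : Type*} (act : Z → α → Z) (E : Set Z) (z₀ : Z) :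
    ∃ G E' : Set Z, (E' = E ∨ E' = Eᶜ) ∧ z₀ ∈ G ∧ IsRecurrent act G E' := by
  obtain ⟨q, ⟨hq, hsubst⟩, hqq⟩ := exists_idempotent_lineUltrafilter (α := α)
  set p : Ultrafilter (FreeMonoid α) := q.map (substWord (Classical.arbitrary α)) with hp_def
  have hpp : p * p = p := by rw [hp_def, ← map_substWord_mul, hqq]
  let run (w : Z) (s : FreeMonoid α) : Z := s.toList.foldl act w
  have run_mul (w s s') : run w (s * s') = run (run w s) s' := List.foldl_append
  let pre (v : FreeMonoid (Option α)) : FreeMonoid α := .ofList (constPrefix v.toList)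
  let P (E' : Set Z) (w : Z) (s : FreeMonoid α) (v : FreeMonoid (Option α)) : Prop :=
    run w (s * pre v) ∈ E'
  obtain ⟨E', hE', hz₀⟩ : ∃ E', (E' = E ∨ E' = Eᶜ) ∧ ∀ᶠ s in p, ∀ᶠ v in q, P E' z₀ s v := by
    by_cases h : ∀ᶠ s in p, ∀ᶠ v in q, P E z₀ s v
    · exact ⟨E, .inl rfl, h⟩
    · exact ⟨Eᶜ, .inr rfl,
        (Ultrafilter.eventually_not.2 h).mono fun _ => Ultrafilter.eventually_not.2⟩
  refine ⟨{w | ∀ᶠ s in p, ∀ᶠ v in q, P E' w s v}, E', hE', hz₀, fun W hW hWG S => ?_⟩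
  obtain ⟨s, v, hs, hv, hsv⟩ :=
    exists_recurrent_variableWord hq hpp (fun f => hsubst f _) hW (fun _ hw => hWG hw) S
  obtain ⟨z, hz⟩ := exists_eq_constPrefix_append hv
  refine ⟨s.toList ++ constPrefix v.toList, z, List.append_ne_nil_of_left_ne_nil hs _,
    fun w hw => ⟨(hsv w hw).1, fun f hf => ?_⟩⟩
  have hsubst_v : (s * substWord f v).toList =
      s.toList ++ constPrefix v.toList ++ f :: z.map (·.getD f) := by
    rw [FreeMonoid.toList_mul, toList_substWord, List.append_assoc]
    conv_lhs => rw [hz]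
    simp
  rw [← hsubst_v]
  change ∀ᶠ u in p, ∀ᶠ v' in q, P E' (run w (s * substWord f v)) u v'
  refine ((hsv w hw).2 f hf).mono fun u hu => hu.mono fun v' hv' => ?_
  simpa only [P, mul_assoc, run_mul] using hv'

end VariableWords

/-! ### Path systems -/

section PathSystems

/-- `IsPathBetween src tgt m l n`: the list `l` of edges is a path from `m` to `n`, where the edge
`e` leads from `src e` to `tgt e`. -/
def IsPathBetween {E : Type*} (src tgt : E → ℕ) : ℕ → List E → ℕ → Prop
  | m, [], n => m = n
  | m, e :: l, n => src e = m ∧ IsPathBetween src tgt (tgt e) l n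

theorem isPathBetween_append {E : Type*} {src tgt : E → ℕ} {l l' : List E} {m n : ℕ} :
    IsPathBetween src tgt m (l ++ l') n ↔
      ∃ k, IsPathBetween src tgt m l k ∧ IsPathBetween src tgt k l' n := by
  induction l generalizing m with
  | nil => simp [IsPathBetween]
  | cons e l ih => simp [IsPathBetween, ih, and_assoc]

/-- A system of edges leading upwards between natural numbers, finitely many between any two of
them, together with a notion of an edge being spanned by a path with the same end points. For fat
subtrees the vertices are the levels of the tree and the edges are the members `u ℓ`. -/
structure PathSystem (E : Type*) where
  src : E → ℕ
  tgt : E → ℕ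
  Spans : List E → E → Prop
  src_lt_tgt : ∀ e, src e < tgt e
  isPath_of_spans : ∀ {l e}, Spans l e → IsPathBetween src tgt (src e) l (tgt e)
  spans_singleton : ∀ e, Spans [e] e
  spans_subst : ∀ {l₁ l l₂ d e}, Spans (l₁ ++ d :: l₂) e → Spans l d → Spans (l₁ ++ l ++ l₂) e
  finite_edges : ∀ m n, {e | src e = m ∧ tgt e = n}.Finite

namespace PathSystem

variable {E : Type*} {P : PathSystem E}

variable (P) in
/-- The list `l` of edges is a path from `m` to `n`. -/
abbrev IsPath (m : ℕ) (l : List E) (n : ℕ) : Prop := IsPathBetween P.src P.tgt m l n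

theorem IsPath.snoc {y : List E} {m : ℕ} {e : E} (hy : P.IsPath m y (P.src e)) :
    P.IsPath m (y ++ [e]) (P.tgt e) :=
  isPathBetween_append.2 ⟨_, hy, rfl, rfl⟩

theorem IsPath.le {l : List E} {m n : ℕ} (h : P.IsPath m l n) : m ≤ n := by
  induction l generalizing m with
  | nil => exact Nat.le_of_eq h
  | cons e l ih => exact h.1 ▸ (P.src_lt_tgt e).le.trans (ih h.2)

theorem IsPath.right_unique {l : List E} {m n n' : ℕ} (h : P.IsPath m l n)
    (h' : P.IsPath m l n') : n = n' := by
  induction l generalizing m with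
  | nil => exact h.symm.trans h'
  | cons e l ih => exact ih h.2 h'.2

theorem IsPath.tgt_le {y : List E} {m n : ℕ} (h : P.IsPath m y n) {e : E} (he : e ∈ y) :
    P.tgt e ≤ n := by
  obtain ⟨l, l', rfl⟩ := List.append_of_mem he
  obtain ⟨_, _, _, h'⟩ := isPathBetween_append.1 h
  exact IsPath.le h'

theorem finite_setOf_isPath (m n : ℕ) : {l | P.IsPath m l n}.Finite := by
  induction hk : n - m using Nat.strong_induction_on generalizing m with
  | _ k ih =>
    have hsub : {l | P.IsPath m l n} ⊆ {[]} ∪ ⋃ c ∈ Set.Ioc m n,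
        Set.image2 List.cons {e | P.src e = m ∧ P.tgt e = c} {l | P.IsPath c l n} := by
      rintro (_ | ⟨e, l⟩) hl
      · exact .inl rfl
      · exact .inr (Set.mem_iUnion₂.2
          ⟨P.tgt e, ⟨hl.1 ▸ P.src_lt_tgt e, IsPath.le hl.2⟩, e, ⟨hl.1, rfl⟩, l, hl.2, rfl⟩)
    refine ((Set.finite_singleton _).union
      ((Set.finite_Ioc m n).biUnion fun c ⟨hmc, hcn⟩ => ?_)).subset hsub
    exact (P.finite_edges m c).image2 _ (ih (n - c) (by omega) c rfl)

theorem src_eq_and_tgt_eq_of_spans {l : List E} {e : E} {m n : ℕ} (h : P.Spans l e)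
    (hl : P.IsPath m l n) : P.src e = m ∧ P.tgt e = n := by
  have h' := P.isPath_of_spans h
  have hm : P.src e = m := by
    cases l with
    | nil => exact absurd h' (P.src_lt_tgt e).ne
    | cons d l => exact h'.1.symm.trans hl.1
  exact ⟨hm, IsPath.right_unique h' (hm ▸ hl)⟩

variable (P) in
/-- The infinite paths of a path system that start at `0`; these are the infinite fat subtrees. -/
@[ext]
structure InfPath where
  edge : ℕ → E
  src_zero : P.src (edge 0) = 0
  src_succ : ∀ i, P.src (edge (i + 1)) = P.tgt (edge i)

namespace InfPath

instance : CoeFun P.InfPath fun _ => ℕ → E := ⟨edge⟩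

variable {U V W A : P.InfPath} {y : List E} {e : E} {d i j k n : ℕ}

theorem strictMono_src (U : P.InfPath) : StrictMono fun i => P.src (U i) :=
  strictMono_nat_of_lt_succ fun i => (U.src_succ i).symm ▸ P.src_lt_tgt _

/-- The segment of an infinite path that consists of the edges with indices in `[i, j)`. -/
def seg (U : P.InfPath) (i j : ℕ) : List E := (List.Ico i j).map U

theorem length_seg (U : P.InfPath) (i j : ℕ) : (U.seg i j).length = j - i := by
  rw [seg, List.length_map, List.Ico.length]

theorem getElem_seg (U : P.InfPath) {i j r : ℕ} (h : r < (U.seg i j).length) :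
    (U.seg i j)[r] = U (i + r) := by
  simp only [seg, List.getElem_map, List.Ico, List.getElem_range', one_mul]

theorem mem_seg : e ∈ U.seg i j ↔ ∃ r, (i ≤ r ∧ r < j) ∧ U r = e := by
  simp only [seg, List.mem_map, List.Ico.mem]

theorem seg_self (U : P.InfPath) (i : ℕ) : U.seg i i = [] := by
  rw [seg, List.Ico.self_empty, List.map_nil]

theorem seg_eq_cons (U : P.InfPath) (h : i < j) : U.seg i j = U i :: U.seg (i + 1) j := by
  rw [seg, List.Ico.eq_cons h, List.map_cons, seg]

theorem seg_append (U : P.InfPath) (h : i ≤ j) (h' : j ≤ k) :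
    U.seg i j ++ U.seg j k = U.seg i k := by
  rw [seg, seg, ← List.map_append, List.Ico.append_consecutive h h', seg]

theorem seg_succ (U : P.InfPath) (h : i ≤ j) : U.seg i (j + 1) = U.seg i j ++ [U j] := by
  rw [seg, List.Ico.succ_top h, List.map_append, List.map_singleton, seg]

theorem seg_eq_seg_iff : U.seg i j = V.seg i j ↔ ∀ r, i ≤ r → r < j → U r = V r := by
  simp only [seg, List.map_inj_left, List.Ico.mem, and_imp]

theorem isPath_seg (U : P.InfPath) (h : i ≤ j) :
    P.IsPath (P.src (U i)) (U.seg i j) (P.src (U j)) := by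
  induction j, h using Nat.le_induction with
  | base => rw [seg_self]; rfl
  | succ j hij ih => rw [seg_succ U hij, U.src_succ]; exact ih.snoc

theorem isPath_seg_zero (U : P.InfPath) (n : ℕ) : P.IsPath 0 (U.seg 0 n) (P.src (U n)) := by
  simpa only [U.src_zero] using U.isPath_seg (Nat.zero_le n)

theorem lt_of_spans_seg (h : P.Spans (U.seg i j) e) : i < j := by
  by_contra hij
  rw [seg, List.Ico.eq_nil_of_le (not_lt.1 hij)] at h
  exact absurd (P.isPath_of_spans h) (P.src_lt_tgt e).ne

theorem src_eq_of_spans_seg (h : P.Spans (U.seg i j) e) : P.src e = P.src (U i) :=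
  (src_eq_and_tgt_eq_of_spans h (U.isPath_seg (lt_of_spans_seg h).le)).1

theorem tgt_eq_of_spans_seg (h : P.Spans (U.seg i j) e) : P.tgt e = P.src (U j) :=
  (src_eq_and_tgt_eq_of_spans h (U.isPath_seg (lt_of_spans_seg h).le)).2

/-- The edges that are spanned by segments of an infinite path. -/
def span (U : P.InfPath) : Set E := {e | ∃ i j, P.Spans (U.seg i j) e}

theorem mem_span_self (U : P.InfPath) (i : ℕ) : U i ∈ U.span :=
  ⟨i, i + 1, by rw [seg_succ U le_rfl, seg_self]; exact P.spans_singleton _⟩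

theorem exists_spans_seg_of_mem_span (he : e ∈ U.span) (hi : P.src e = P.src (U i)) :
    ∃ j, P.Spans (U.seg i j) e := by
  obtain ⟨i', j, h⟩ := he
  obtain rfl : i' = i := U.strictMono_src.injective ((src_eq_of_spans_seg h).symm.trans hi)
  exact ⟨j, h⟩

theorem exists_spans_seg_of_append {l : List E} (hij : i ≤ j) (hl : P.IsPath (P.src (U j)) l n)
    (hs : ∀ d ∈ l, d ∈ U.span) (h : P.Spans (U.seg i j ++ l) e) :
    ∃ k, P.Spans (U.seg i k) e := by
  induction l generalizing j with
  | nil => exact ⟨j, by rwa [List.append_nil] at h⟩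
  | cons d l ih =>
    obtain ⟨k, hk⟩ := exists_spans_seg_of_mem_span (hs d List.mem_cons_self) hl.1
    have hjk := lt_of_spans_seg hk
    refine ih (hij.trans hjk.le) (tgt_eq_of_spans_seg hk ▸ hl.2)
      (fun d' hd' => hs d' (List.mem_cons_of_mem _ hd')) ?_
    rw [← seg_append U hij hjk.le]
    exact P.spans_subst h hk

theorem mem_span_of_spans {l : List E} (h : P.Spans l e) (hl : ∀ d ∈ l, d ∈ U.span) :
    e ∈ U.span := by
  have hpath := P.isPath_of_spans h
  cases l with
  | nil => exact absurd hpath (P.src_lt_tgt e).ne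
  | cons d l =>
    obtain ⟨i, j, hd⟩ := hl d List.mem_cons_self
    rw [← hpath.1, src_eq_of_spans_seg hd] at hpath
    have hi : P.Spans (U.seg i i ++ d :: l) e := by rwa [seg_self]
    exact ⟨i, exists_spans_seg_of_append le_rfl hpath hl hi⟩

/-- `V ≤ U` if every edge of `V` is spanned by `U`, as for the order on fat subtrees. -/
instance : Preorder P.InfPath where
  le V U := ∀ i, V i ∈ U.span
  le_refl := mem_span_self
  le_trans _ _ _ hWV hVU i := by
    obtain ⟨a, b, h⟩ := hWV i
    refine mem_span_of_spans h fun d hd => ?_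
    obtain ⟨r, -, rfl⟩ := mem_seg.1 hd
    exact hVU r

theorem span_mono (h : V ≤ U) : V.span ⊆ U.span := fun e ⟨a, b, he⟩ =>
  mem_span_of_spans he fun d hd => by
    obtain ⟨r, -, rfl⟩ := mem_seg.1 hd
    exact h r

theorem mem_span_of_mem_seg (h : V ≤ U) (he : e ∈ V.seg i j) : e ∈ U.span := by
  obtain ⟨r, -, rfl⟩ := mem_seg.1 he
  exact h r

/-- The set `[d, U]` of the infinite paths spanned by `U` that agree with `U` below index `d`. -/
def cone (U : P.InfPath) (d : ℕ) : Set P.InfPath := {V | V ≤ U ∧ ∀ i < d, V i = U i}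

theorem self_mem_cone (U : P.InfPath) (d : ℕ) : U ∈ U.cone d := ⟨le_rfl, fun _ _ => rfl⟩

theorem mem_cone_trans {d' : ℕ} (hV : V ∈ U.cone d) (hW : W ∈ V.cone d') (h : d ≤ d') :
    W ∈ U.cone d :=
  ⟨hW.1.trans hV.1, fun i hi => (hW.2 i (hi.trans_le h)).trans (hV.2 i hi)⟩

theorem src_eq_of_mem_cone (hV : V ∈ U.cone d) : P.src (V d) = P.src (U d) := by
  cases d with
  | zero => rw [V.src_zero, U.src_zero]
  | succ i => rw [V.src_succ, U.src_succ, hV.2 i (Nat.lt_succ_self i)]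

/-- `y` is a finite path from `0` whose edges are spanned by `U`, and its depth in `U` is `d`. -/
def HasDepth (U : P.InfPath) (y : List E) (d : ℕ) : Prop :=
  P.IsPath 0 y (P.src (U d)) ∧ ∀ e ∈ y, e ∈ U.span

theorem hasDepth_seg (U : P.InfPath) (d : ℕ) : U.HasDepth (U.seg 0 d) d :=
  ⟨U.isPath_seg_zero d, fun _ => mem_span_of_mem_seg le_rfl⟩

theorem HasDepth.mono (hy : V.HasDepth y d) (h : V ≤ U) (hk : P.src (V d) = P.src (U k)) :
    U.HasDepth y k :=
  ⟨hk ▸ hy.1, fun e he => span_mono h (hy.2 e he)⟩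

theorem HasDepth.of_mem_cone (hy : U.HasDepth y d) (hV : V ∈ U.cone d) : V.HasDepth y d := by
  refine ⟨src_eq_of_mem_cone hV ▸ hy.1, fun e he => ?_⟩
  obtain ⟨i, j, h⟩ := hy.2 e he
  have hj : j ≤ d :=
    U.strictMono_src.le_iff_le.1 (tgt_eq_of_spans_seg h ▸ hy.1.tgt_le he)
  refine ⟨i, j, ?_⟩
  rwa [seg_eq_seg_iff.2 fun r _ hr => hV.2 r (hr.trans_le hj)]

theorem HasDepth.snoc (hy : U.HasDepth y d) (he : e ∈ U.span) (hd : P.src e = P.src (U d)) :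
    ∃ k > d, U.HasDepth (y ++ [e]) k := by
  obtain ⟨k, hk⟩ := exists_spans_seg_of_mem_span he hd
  refine ⟨k, lt_of_spans_seg hk, ?_, List.forall_mem_append.2 ⟨hy.2, by simpa using he⟩⟩
  rw [← tgt_eq_of_spans_seg hk]
  exact IsPath.snoc (hd ▸ hy.1)

theorem exists_hasDepth (hy : P.IsPath 0 y n) (hs : ∀ e ∈ y, e ∈ U.span) :
    ∃ k, U.HasDepth y k ∧ P.src (U k) = n := by
  suffices ∃ k, P.src (U k) = n by
    obtain ⟨k, rfl⟩ := this
    exact ⟨k, ⟨hy, hs⟩, rfl⟩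
  rcases List.eq_nil_or_concat y with rfl | ⟨l, e, rfl⟩
  · exact ⟨0, U.src_zero.trans hy⟩
  · rw [List.concat_eq_append] at hy hs
    obtain ⟨_, _, _, rfl⟩ := isPathBetween_append.1 hy
    obtain ⟨i, j, h⟩ := hs e (List.mem_append_right _ (List.mem_singleton_self e))
    exact ⟨j, (tgt_eq_of_spans_seg h).symm⟩

/-- The set `[y, U]` of the infinite paths spanned by `U` that have `y` as an initial segment. -/
def cylinder (y : List E) (U : P.InfPath) : Set P.InfPath := {A | A ≤ U ∧ A.seg 0 y.length = y}

theorem cylinder_mono (h : V ≤ U) : cylinder y V ⊆ cylinder y U :=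
  fun _ hA => ⟨hA.1.trans h, hA.2⟩

theorem mem_cylinder_seg : A ∈ cylinder (V.seg 0 n) U ↔ A ≤ U ∧ ∀ i < n, A i = V i := by
  simp only [cylinder, Set.mem_ofPred_eq, length_seg, Nat.sub_zero, seg_eq_seg_iff, zero_le,
    forall_true_left]

theorem src_length_of_mem_cylinder (hA : A ∈ cylinder y U) (hy : P.IsPath 0 y n) :
    P.src (A y.length) = n :=
  (hA.2 ▸ A.isPath_seg_zero y.length).right_unique hy

theorem HasDepth.seg_of_mem_cylinder (hy : U.HasDepth y d) (hA : A ∈ cylinder y U)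
    (hn : y.length ≤ n) : ∃ k ≥ d, U.HasDepth (A.seg 0 n) k := by
  induction n, hn using Nat.le_induction with
  | base => exact ⟨d, le_rfl, hA.2.symm ▸ hy⟩
  | succ n _ ih =>
    obtain ⟨k, hdk, hk⟩ := ih
    obtain ⟨k', hk', h⟩ := hk.snoc (hA.1 n) ((A.isPath_seg_zero n).right_unique hk.1)
    exact ⟨k', hdk.trans hk'.le, by rwa [seg_succ A (Nat.zero_le n)]⟩

theorem isPath_appendStream {l : List E} {s : Stream' E} {m : ℕ}
    (hl : P.IsPath m l (P.src (s.get 0))) (hs : ∀ i, P.src (s.get (i + 1)) = P.tgt (s.get i)) :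
    P.src ((l ++ₛ s).get 0) = m ∧
      ∀ i, P.src ((l ++ₛ s).get (i + 1)) = P.tgt ((l ++ₛ s).get i) := by
  induction l generalizing m with
  | nil => exact ⟨hl.symm, hs⟩
  | cons e l ih =>
    obtain ⟨h₀, h₁⟩ := ih hl.2
    refine ⟨hl.1, fun i => ?_⟩
    cases i with
    | zero => exact h₀
    | succ i => exact h₁ i

/-- The infinite path that follows `y` first and `A` from the index `k` on afterwards. -/
def graft (y : List E) (A : P.InfPath) (k : ℕ) (h : P.IsPath 0 y (P.src (A k))) : P.InfPath :=
  have h' := isPath_appendStream (s := fun i => A (k + i)) h fun i => A.src_succ (k + i)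
  ⟨(y ++ₛ fun i => A (k + i)).get, h'.1, h'.2⟩

theorem graft_apply_of_lt (h : P.IsPath 0 y (P.src (A k))) (hi : i < y.length) :
    graft y A k h i = y[i] :=
  Stream'.get_append_left ..

theorem graft_apply_length_add (h : P.IsPath 0 y (P.src (A k))) (i : ℕ) :
    graft y A k h (y.length + i) = A (k + i) :=
  Stream'.get_append_right ..

theorem graft_apply_of_length_le (h : P.IsPath 0 y (P.src (A k))) (hi : y.length ≤ i) :
    graft y A k h i = A (k + (i - y.length)) := by
  rw [← graft_apply_length_add h, Nat.add_sub_cancel' hi]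

theorem seg_graft (h : P.IsPath 0 y (P.src (A k))) : (graft y A k h).seg 0 y.length = y := by
  refine List.ext_getElem (length_seg _ _ _) fun i _ hi => ?_
  rw [getElem_seg, zero_add, graft_apply_of_lt h hi]

theorem graft_le (h : P.IsPath 0 y (P.src (A k))) (hy : ∀ e ∈ y, e ∈ U.span)
    (hA : ∀ i ≥ k, A i ∈ U.span) : graft y A k h ≤ U := by
  intro i
  rcases lt_or_ge i y.length with hi | hi
  · exact graft_apply_of_lt h hi ▸ hy _ (List.getElem_mem hi)
  · exact graft_apply_of_length_le h hi ▸ hA _ (Nat.le_add_right _ _)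

theorem graft_seg_mem_cone (h : P.IsPath 0 (U.seg 0 d) (P.src (A k)))
    (hA : ∀ i ≥ k, A i ∈ U.span) : graft (U.seg 0 d) A k h ∈ U.cone d := by
  refine ⟨graft_le h (fun _ => mem_span_of_mem_seg le_rfl) hA, fun i hi => ?_⟩
  have hseg := seg_graft h
  rw [length_seg, Nat.sub_zero] at hseg
  exact seg_eq_seg_iff.1 hseg i (Nat.zero_le i) hi

theorem mem_span_of_mem_span_graft (h : P.IsPath 0 y (P.src (A k)))
    (he : e ∈ (graft y A k h).span) (hk : P.src (A k) ≤ P.src e) : e ∈ A.span := by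
  obtain ⟨i, j, hij⟩ := he
  have hi : y.length ≤ i := by
    have hlen : graft y A k h y.length = A k := graft_apply_length_add h 0
    rw [src_eq_of_spans_seg hij, ← hlen] at hk
    exact (strictMono_src _).le_iff_le.1 hk
  refine mem_span_of_spans hij fun e he => ?_
  obtain ⟨r, ⟨hr, -⟩, rfl⟩ := mem_seg.1 he
  exact graft_apply_of_length_le h (hi.trans hr) ▸ mem_span_self A _

theorem HasDepth.cylinder_nonempty (hy : U.HasDepth y d) : (cylinder y U).Nonempty :=
  ⟨graft y U d hy.1, graft_le hy.1 hy.2 fun i _ => mem_span_self U i, seg_graft hy.1⟩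

theorem exists_mem_cone_apply_add {s : ℕ → E} (h₀ : P.src (s 0) = P.src (U d))
    (hs : ∀ i, P.src (s (i + 1)) = P.tgt (s i)) (hU : ∀ i, s i ∈ U.span) :
    ∃ V ∈ U.cone d, ∀ i, V (d + i) = s i := by
  have h := isPath_appendStream (s := s) (h₀ ▸ U.isPath_seg_zero d) hs
  have hlen : (U.seg 0 d).length = d := length_seg U 0 d
  let V : P.InfPath := ⟨(U.seg 0 d ++ₛ s).get, h.1, h.2⟩
  have hadd (i : ℕ) : V (d + i) = s i := by
    conv_lhs => rw [← hlen]
    exact Stream'.get_append_right ..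
  have hlt (i : ℕ) (hi : i < d) : V i = U i := by
    have hget : V i = (U.seg 0 d)[i] := Stream'.get_append_left ..
    rw [hget, getElem_seg, zero_add]
  refine ⟨V, ⟨fun i => ?_, hlt⟩, hadd⟩
  rcases lt_or_ge i d with hi | hi
  · exact hlt i hi ▸ mem_span_self U i
  · obtain ⟨i, rfl⟩ := Nat.exists_eq_add_of_le hi
    exact hadd i ▸ hU i

/-! ### Fusion -/

theorem exists_forall_mem_cone {V : ℕ → P.InfPath} (hV : ∀ r, V (r + 1) ∈ (V r).cone (d + r)) :
    ∃ W : P.InfPath, ∀ r, W ∈ (V r).cone (d + r) := by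
  have hcone : ∀ r s, r ≤ s → V s ∈ (V r).cone (d + r) := by
    intro r s hrs
    induction s, hrs using Nat.le_induction with
    | base => exact self_mem_cone _ _
    | succ s hrs ih => exact mem_cone_trans ih (hV s) (Nat.add_le_add_left hrs d)
  have hdiag : ∀ r i, i < d + r → V (i + 1) i = V r i := by
    intro r i hi
    rcases le_total r (i + 1) with h | h
    · exact (hcone r (i + 1) h).2 i hi
    · exact ((hcone (i + 1) r h).2 i (by omega)).symm
  refine ⟨⟨fun i => V (i + 1) i, (V 1).src_zero, fun i => ?_⟩, fun r => ⟨fun i => ?_, hdiag r⟩⟩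
  · rw [hdiag (i + 2) i (by omega)]
    exact (V (i + 2)).src_succ i
  · change V (i + 1) i ∈ _
    rw [hdiag (max r (i + 1)) i (by omega)]
    exact (hcone r _ (le_max_left _ _)).1 i

section Fusion

variable {Good : List E → Set P.InfPath} (hered : ∀ y, IsLowerSet (Good y))
  (dense : ∀ (U : P.InfPath) d y, U.HasDepth y d → ∃ V ∈ U.cone d, V ∈ Good y)

include hered dense

theorem exists_mem_cone_forall_mem {S : Set (List E)} (hS : S.Finite) :
    (∀ y ∈ S, U.HasDepth y d) → ∃ V ∈ U.cone d, ∀ y ∈ S, V ∈ Good y := by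
  induction S, hS using Set.Finite.induction_on with
  | empty => exact fun _ => ⟨U, self_mem_cone U d, fun _ h => h.elim⟩
  | @insert y S _ _ ih =>
    intro hU
    obtain ⟨hy, hS⟩ := Set.forall_mem_insert.1 hU
    obtain ⟨V, hV, hgood⟩ := ih hS
    obtain ⟨W, hW, hWy⟩ := dense V d y (hy.of_mem_cone hV)
    exact ⟨W, mem_cone_trans hV hW le_rfl,
      Set.forall_mem_insert.2 ⟨hWy, fun z hz => hered z hW.1 (hgood z hz)⟩⟩

theorem exists_mem_cone_forall_hasDepth (U : P.InfPath) (d : ℕ) :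
    ∃ V ∈ U.cone d, ∀ d' ≥ d, ∀ y, V.HasDepth y d' → V ∈ Good y := by
  have hstep : ∀ (r : ℕ) (U : P.InfPath),
      ∃ V ∈ U.cone (d + r), ∀ y, U.HasDepth y (d + r) → V ∈ Good y := fun r U =>
    exists_mem_cone_forall_mem hered dense
      ((finite_setOf_isPath 0 (P.src (U (d + r)))).subset fun _ hy => hy.1) fun _ hy => hy
  choose next hnext hgood using hstep
  let V : ℕ → P.InfPath := Nat.rec U next
  obtain ⟨W, hW⟩ := exists_forall_mem_cone (V := V) fun r => hnext r (V r)
  refine ⟨W, hW 0, fun d' hd' y hy => ?_⟩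
  obtain ⟨r, rfl⟩ := Nat.exists_eq_add_of_le hd'
  exact hered y (hW (r + 1)).1 (hgood r (V r) y (hy.mono (hW r).1 (src_eq_of_mem_cone (hW r))))

end Fusion

/-! ### Combinatorial forcing -/

variable (P) in
/-- The pigeonhole principle for the edges that extend a path of given depth. -/
def _root_.PathSystem.Pigeonhole : Prop :=
  ∀ (U : P.InfPath) (d : ℕ) (O : Set E), ∃ V ∈ U.cone d,
    (∀ e ∈ V.span, P.src e = P.src (U d) → e ∈ O) ∨ ∀ e ∈ V.span, P.src e = P.src (U d) → e ∉ O

variable {X : Set P.InfPath}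

/-- In the terminology of Galvin and Prikry: no infinite path spanned by `U` accepts `y`. -/
def Rejects (X : Set P.InfPath) (y : List E) (U : P.InfPath) : Prop :=
  ∀ W ≤ U, ∀ k, W.HasDepth y k → ¬ cylinder y W ⊆ X

theorem Rejects.mono (h : Rejects X y U) (hVU : V ≤ U) : Rejects X y V :=
  fun W hW => h W (hW.trans hVU)

theorem cylinder_graft_subset (hd : P.IsPath 0 (U.seg 0 d) (P.src (W k)))
    (hy : W.HasDepth y k) : cylinder y (graft (U.seg 0 d) W k hd) ⊆ cylinder y W := by
  refine fun A hA => ⟨fun i => ?_, hA.2⟩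
  rcases lt_or_ge i y.length with hi | hi
  · exact hy.2 _ (hA.2 ▸ mem_seg.2 ⟨i, ⟨Nat.zero_le i, hi⟩, rfl⟩)
  · refine mem_span_of_mem_span_graft hd (hA.1 i) ?_
    exact src_length_of_mem_cylinder hA hy.1 ▸ A.strictMono_src.monotone hi

theorem HasDepth.exists_accepts_or_rejects (X : Set P.InfPath) (hy : U.HasDepth y d) :
    ∃ V ∈ U.cone d, cylinder y V ⊆ X ∨ Rejects X y V := by
  by_cases h : Rejects X y U
  · exact ⟨U, self_mem_cone U d, .inr h⟩
  · simp only [Rejects, not_forall, not_not] at h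
    obtain ⟨W, hWU, k, hk, hX⟩ := h
    have hd : P.IsPath 0 (U.seg 0 d) (P.src (W k)) :=
      IsPath.right_unique hy.1 hk.1 ▸ U.isPath_seg_zero d
    exact ⟨graft (U.seg 0 d) W k hd, graft_seg_mem_cone hd fun i _ => hWU i,
      .inl ((cylinder_graft_subset hd hk).trans hX)⟩

theorem Rejects.exists_rejects_snoc (hP : P.Pigeonhole) (hrej : Rejects X y U)
    (hy : U.HasDepth y d)
    (hdec : ∀ d' ≥ d, ∀ z, U.HasDepth z d' → cylinder z U ⊆ X ∨ Rejects X z U) :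
    ∃ V ∈ U.cone d, ∀ e ∈ V.span, P.src e = P.src (U d) → Rejects X (y ++ [e]) V := by
  obtain ⟨V, hV, hO⟩ := hP U d {e | cylinder (y ++ [e]) U ⊆ X}
  refine ⟨V, hV, fun e he hed => ?_⟩
  rcases hO with hacc | hO
  · refine absurd (fun A hA => ?_) (hrej V hV.1 d (hy.of_mem_cone hV))
    refine hacc (A y.length) (hA.1 _) (src_length_of_mem_cylinder hA hy.1)
      ⟨hA.1.trans hV.1, ?_⟩
    rw [List.length_append, List.length_singleton, seg_succ A (Nat.zero_le _), hA.2]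
  · obtain ⟨k, hk, hyk⟩ := hy.snoc (span_mono hV.1 he) hed
    exact ((hdec k hk.le _ hyk).resolve_left (hO e he hed)).mono hV.1

theorem HasDepth.exists_accepts_or_rejects_snoc (hP : P.Pigeonhole) (X : Set P.InfPath)
    (hy : U.HasDepth y d) :
    ∃ V ∈ U.cone d, cylinder y V ⊆ X ∨ Rejects X y V ∧
      ∀ e ∈ V.span, P.src e = P.src (U d) → Rejects X (y ++ [e]) V := by
  obtain ⟨V, hV, hdec⟩ := exists_mem_cone_forall_hasDepth
    (Good := fun y => {V | cylinder y V ⊆ X ∨ Rejects X y V})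
    (fun y _ _ h => Or.imp (cylinder_mono h).trans (Rejects.mono · h))
    (fun _ _ _ hy => hy.exists_accepts_or_rejects X) U d
  rcases hdec d le_rfl y (hy.of_mem_cone hV) with hacc | hrej
  · exact ⟨V, hV, .inl hacc⟩
  · obtain ⟨W, hW, h⟩ := hrej.exists_rejects_snoc hP (hy.of_mem_cone hV) hdec
    exact ⟨W, mem_cone_trans hV hW le_rfl,
      .inr ⟨hrej.mono hW.1, src_eq_of_mem_cone hV ▸ h⟩⟩

theorem HasDepth.exists_accepts_or_forall_rejects (hP : P.Pigeonhole) (X : Set P.InfPath)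
    (hy : U.HasDepth y d) :
    ∃ V ∈ U.cone d, cylinder y V ⊆ X ∨
      ∀ A ∈ cylinder y V, ∀ n ≥ y.length, Rejects X (A.seg 0 n) V := by
  obtain ⟨V, hV, hdec⟩ := exists_mem_cone_forall_hasDepth
    (Good := fun y => {V | cylinder y V ⊆ X ∨ Rejects X y V ∧
      ∀ e ∈ V.span, P.IsPath 0 y (P.src e) → Rejects X (y ++ [e]) V})
    (fun y _ _ h => Or.imp (cylinder_mono h).trans fun hrej =>
      ⟨hrej.1.mono h, fun e he hye => (hrej.2 e (span_mono h he) hye).mono h⟩)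
    (fun U d y hy => by
      obtain ⟨V, hV, h⟩ := hy.exists_accepts_or_rejects_snoc hP X
      exact ⟨V, hV, h.imp_right fun h =>
        ⟨h.1, fun e he hye => h.2 e he (IsPath.right_unique hye hy.1)⟩⟩) U d
  have hyV := hy.of_mem_cone hV
  refine ⟨V, hV, (hdec d le_rfl y hyV).imp_right fun h A hA n hn => ?_⟩
  induction n, hn using Nat.le_induction with
  | base => exact hA.2.symm ▸ h.1
  | succ n hn ih =>
    obtain ⟨k, hk, hAk⟩ := hyV.seg_of_mem_cylinder hA hn
    have hsnoc := ((hdec k hk _ hAk).resolve_left (ih V le_rfl k hAk)).2 (A n) (hA.1 n)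
      (A.isPath_seg_zero n)
    rwa [seg_succ A (Nat.zero_le n)]

/-! ### The Ellentuck topology -/

/-- The Ellentuck topology. -/
instance : TopologicalSpace P.InfPath :=
  TopologicalSpace.generateFrom {s | ∃ y U, s = cylinder y U}

theorem isOpen_cylinder (y : List E) (U : P.InfPath) : IsOpen (cylinder y U) :=
  TopologicalSpace.isOpen_generateFrom_of_mem ⟨y, U, rfl⟩

theorem exists_cylinder_seg_subset (hX : IsOpen X) (hA : A ∈ X) :
    ∃ m, ∀ n ≥ m, cylinder (A.seg 0 n) A ⊆ X := by
  induction hX with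
  | basic s hs =>
    obtain ⟨y, U, rfl⟩ := hs
    refine ⟨y.length, fun n hn B hB => ⟨hB.1.trans hA.1, ?_⟩⟩
    rw [← hA.2, length_seg, Nat.sub_zero, seg_eq_seg_iff]
    exact fun r _ hr => (mem_cylinder_seg.1 hB).2 r (hr.trans_le hn)
  | univ => exact ⟨0, fun _ _ => Set.subset_univ _⟩
  | inter s t _ _ ihs iht =>
    obtain ⟨m, hm⟩ := ihs hA.1
    obtain ⟨m', hm'⟩ := iht hA.2
    exact ⟨max m m', fun n hn =>
      Set.subset_inter (hm n (le_of_max_le_left hn)) (hm' n (le_of_max_le_right hn))⟩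
  | sUnion S _ ih =>
    obtain ⟨s, hs, hAs⟩ := hA
    obtain ⟨m, hm⟩ := ih s hs hAs
    exact ⟨m, fun n hn => (hm n hn).trans (Set.subset_sUnion_of_mem hs)⟩

/-- Ramsey sets of infinite paths. -/
def IsRamsey (X : Set P.InfPath) : Prop :=
  ∀ (U : P.InfPath) d y, U.HasDepth y d → ∃ V ∈ U.cone d,
    cylinder y V ⊆ X ∨ Disjoint (cylinder y V) X

/-- Ramsey null sets of infinite paths. -/
def IsRamseyNull (X : Set P.InfPath) : Prop :=
  ∀ (U : P.InfPath) d y, U.HasDepth y d → ∃ V ∈ U.cone d, Disjoint (cylinder y V) X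

theorem isRamsey_of_isOpen (hP : P.Pigeonhole) (hX : IsOpen X) : IsRamsey X := by
  intro U d y hy
  obtain ⟨V, hV, h⟩ := hy.exists_accepts_or_forall_rejects hP X
  refine ⟨V, hV, h.imp_right fun hrej => Set.disjoint_left.2 fun A hA hAX => ?_⟩
  obtain ⟨m, hm⟩ := exists_cylinder_seg_subset hX hAX
  exact hrej A hA _ (le_max_right m _) A hA.1 _ (A.hasDepth_seg _) (hm _ (le_max_left m _))

theorem isRamseyNull_of_isNowhereDense (hP : P.Pigeonhole) (hX : IsNowhereDense X) :
    IsRamseyNull X := by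
  intro U d y hy
  obtain ⟨V, hV, h⟩ := isRamsey_of_isOpen hP isClosed_closure.isOpen_compl U d y hy
  refine ⟨V, hV, ?_⟩
  rcases h with h | h
  · exact (Set.subset_compl_iff_disjoint_right.1 h).mono_right subset_closure
  · have hint : cylinder y V ⊆ interior (closure X) :=
      interior_maximal (Set.disjoint_compl_right_iff_subset.1 h) (isOpen_cylinder y V)
    rw [hX] at hint
    exact absurd hint ((hy.of_mem_cone hV).cylinder_nonempty.mono · |>.ne_empty rfl)

theorem IsRamseyNull.mono {Y : Set P.InfPath} (hX : IsRamseyNull X) (h : Y ⊆ X) :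
    IsRamseyNull Y := fun U d y hy =>
  let ⟨V, hV, hd⟩ := hX U d y hy
  ⟨V, hV, hd.mono_right h⟩

theorem IsRamseyNull.biUnion_lt {X : ℕ → Set P.InfPath} (hX : ∀ n, IsRamseyNull (X n)) (n : ℕ) :
    IsRamseyNull (⋃ j < n, X j) := by
  induction n with
  | zero => exact fun U d y _ => ⟨U, self_mem_cone U d, by simp⟩
  | succ n ih =>
    intro U d y hy
    obtain ⟨V, hV, hdV⟩ := ih U d y hy
    obtain ⟨W, hW, hdW⟩ := hX n V d y (hy.of_mem_cone hV)
    rw [Set.biUnion_lt_succ]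
    exact ⟨W, mem_cone_trans hV hW le_rfl,
      Set.disjoint_union_right.2 ⟨hdV.mono_left (cylinder_mono hW.1), hdW⟩⟩

theorem IsRamseyNull.iUnion {X : ℕ → Set P.InfPath} (hX : ∀ n, IsRamseyNull (X n)) :
    IsRamseyNull (⋃ n, X n) := by
  intro U d y hy
  obtain ⟨V, hV, hdisj⟩ := exists_mem_cone_forall_hasDepth
    (Good := fun y => {V | Disjoint (cylinder y V) (⋃ j < y.length, X j)})
    (fun y _ _ h => Disjoint.mono_left (cylinder_mono h))
    (fun U d y hy => biUnion_lt hX y.length U d y hy) U d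
  refine ⟨V, hV, Set.disjoint_iUnion_right.2 fun j => Set.disjoint_left.2 fun A hA hAX => ?_⟩
  obtain ⟨k, hk, hAk⟩ := (hy.of_mem_cone hV).seg_of_mem_cylinder hA (le_max_left y.length (j + 1))
  have hlt : j < (A.seg 0 (max y.length (j + 1))).length := by
    rw [length_seg]
    exact lt_max_of_lt_right (Nat.lt_succ_self j)
  exact Set.disjoint_left.1 (hdisj k hk _ hAk) (mem_cylinder_seg.2 ⟨hA.1, fun _ _ => rfl⟩)
    (Set.mem_biUnion hlt hAX)

theorem isRamseyNull_of_isMeagre (hP : P.Pigeonhole) (hX : IsMeagre X) : IsRamseyNull X := by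
  obtain ⟨S, hS, hcount, hXS⟩ := isMeagre_iff_countable_union_isNowhereDense.1 hX
  obtain ⟨f, hf⟩ := (hcount.insert ∅).exists_eq_range (Set.insert_nonempty _ _)
  have hf' : ∀ n, IsNowhereDense (f n) := fun n =>
    Set.forall_mem_insert.2 ⟨isNowhereDense_empty, hS⟩ (f n) (hf ▸ Set.mem_range_self n)
  refine (IsRamseyNull.iUnion fun n => isRamseyNull_of_isNowhereDense hP (hf' n)).mono ?_
  rw [← Set.sUnion_range, ← hf]
  exact hXS.trans (Set.sUnion_subset_sUnion (Set.subset_insert _ _))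

theorem isRamsey_of_hasBaireProperty (hP : P.Pigeonhole) (hX : HasBaireProperty X) :
    IsRamsey X := by
  obtain ⟨O, N, hO, hN, rfl⟩ := hX
  intro U d y hy
  obtain ⟨V, hV, hVN⟩ := isRamseyNull_of_isMeagre hP hN U d y hy
  obtain ⟨W, hW, hWO⟩ := isRamsey_of_isOpen hP hO V d y (hy.of_mem_cone hV)
  have hWN := hVN.mono_left (cylinder_mono (y := y) hW.1)
  refine ⟨W, mem_cone_trans hV hW le_rfl, hWO.imp (fun h A hA => ?_) fun h => ?_⟩
  · exact .inl ⟨h hA, Set.disjoint_left.1 hWN hA⟩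
  · exact (Set.disjoint_union_right.2 ⟨h, hWN⟩).mono_right symmDiff_le_sup

end InfPath

end PathSystem

end PathSystems

/-! ### Levels and shape-preserving functions -/

section Levels

variable {T A : Type*} [PartialOrder T]

/-- The function `F̃` of a shape-preserving `F`: nodes of level `k` have images of level
`levelMap F k`. The infimum is that of a singleton, or the junk value `0` if level `k` is empty. -/
noncomputable def levelMap (F : T → T) (k : ℕ) : ℕ :=
  sInf ((fun a => nodeLevel (F a)) '' {a | nodeLevel a = k})

namespace STree

variable (τ : STree T A)

include τ

theorem le_or_le_of_le {a b c : T} (ha : a ≤ c) (hb : b ≤ c) : a ≤ b ∨ b ≤ a := by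
  rcases eq_or_lt_of_le ha with rfl | ha
  · exact Or.inr hb
  rcases eq_or_lt_of_le hb with rfl | hb
  · exact Or.inl ha.le
  · exact (τ.chain_below c).total ha hb

theorem strictMono_nodeLevel : StrictMono (nodeLevel : T → ℕ) := fun _ b h =>
  Set.ncard_lt_ncard (Set.Iio_ssubset_Iio h) (τ.finite_below b)

theorem nodeLevel_le {a b : T} (h : a ≤ b) : nodeLevel a ≤ nodeLevel b :=
  τ.strictMono_nodeLevel.monotone h

theorem le_of_nodeLevel_le {a b c : T} (ha : a ≤ c) (hb : b ≤ c)
    (h : nodeLevel a ≤ nodeLevel b) : a ≤ b := by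
  rcases τ.le_or_le_of_le ha hb with hab | hba
  · exact hab
  · rcases eq_or_lt_of_le hba with rfl | hba
    · exact le_rfl
    · exact absurd h (τ.strictMono_nodeLevel hba).not_ge

theorem eq_of_le_of_le {a b c : T} (ha : a ≤ c) (hb : b ≤ c) (h : nodeLevel a = nodeLevel b) :
    a = b :=
  (τ.le_of_nodeLevel_le ha hb h.le).antisymm (τ.le_of_nodeLevel_le hb ha h.ge)

theorem eq_of_le_of_nodeLevel_eq {a b : T} (h : a ≤ b) (hl : nodeLevel a = nodeLevel b) : a = b :=
  τ.eq_of_le_of_le h le_rfl hl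

theorem nodeLevel_covBy {a b : T} (h : a ⋖ b) : nodeLevel b = nodeLevel a + 1 := by
  have hIio : Set.Iio b = insert a (Set.Iio a) := by
    refine Set.Subset.antisymm (fun x hx => ?_)
      (Set.insert_subset h.lt (Set.Iio_subset_Iio h.le))
    rcases τ.le_or_le_of_le hx.le h.le with hxa | hax
    · exact eq_or_lt_of_le hxa
    · exact Or.inl (hax.eq_of_not_lt fun hlt => h.2 hlt hx).symm
  rw [nodeLevel, hIio, Set.ncard_insert_of_notMem Set.self_notMem_Iio (τ.finite_below a), nodeLevel]

theorem nodeLevel_succOp {a b : T} {p : List T} {e : A} (h : τ.succOp a p e = some b) :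
    nodeLevel b = nodeLevel a + 1 :=
  τ.nodeLevel_covBy (τ.succ_spec _ _ _ _ h).1

theorem exists_covBy_le_of_lt {a b : T} (h : a < b) : ∃ c, a ⋖ c ∧ c ≤ b := by
  have hfin : (Set.Ioc a b).Finite :=
    ((τ.finite_below b).insert b).subset fun x hx => eq_or_lt_of_le hx.2
  obtain ⟨c, hc, hmin⟩ := hfin.exists_minimalFor id _ ⟨b, h, le_rfl⟩
  refine ⟨c, ⟨hc.1, fun x hax hxc => ?_⟩, hc.2⟩
  exact hxc.not_ge (hmin ⟨hax, hxc.le.trans hc.2⟩ hxc.le)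

theorem exists_covBy_of_nodeLevel_eq_succ {b : T} {k : ℕ} (h : nodeLevel b = k + 1) :
    ∃ a, a ⋖ b ∧ nodeLevel a = k := by
  have hne : (Set.Iio b).Nonempty := Set.nonempty_of_ncard_ne_zero (h.trans_ne k.succ_ne_zero)
  obtain ⟨a, ha, hmax⟩ := (τ.finite_below b).exists_maximalFor id _ hne
  have hab : a ⋖ b := ⟨ha, fun x hax hxb => hax.not_ge (hmax hxb hax.le)⟩
  exact ⟨a, hab, Nat.succ_injective ((τ.nodeLevel_covBy hab).symm.trans h)⟩

theorem exists_le_nodeLevel_eq {b : T} {k : ℕ} (h : k ≤ nodeLevel b) :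
    ∃ a ≤ b, nodeLevel a = k := by
  obtain ⟨n, hn⟩ := Nat.exists_eq_add_of_le h
  induction n generalizing b with
  | zero => exact ⟨b, le_rfl, hn⟩
  | succ n ih =>
    obtain ⟨b', hb', hn'⟩ := τ.exists_covBy_of_nodeLevel_eq_succ (k := k + n) hn
    obtain ⟨a, ha, hk⟩ := ih (b := b') (by omega) hn'
    exact ⟨a, ha.trans hb'.le, hk⟩

theorem covBy_of_le_of_nodeLevel_eq {a b : T} (h : a ≤ b) (hl : nodeLevel b = nodeLevel a + 1) :
    a ⋖ b := by
  obtain ⟨a', ha', hk⟩ := τ.exists_covBy_of_nodeLevel_eq_succ hl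
  rwa [τ.eq_of_le_of_le h ha'.le hk.symm]

theorem finite_level (k : ℕ) : {a : T | nodeLevel a = k}.Finite := by
  induction k with
  | zero => exact τ.finite_roots
  | succ k ih =>
    refine (ih.biUnion fun a _ => τ.finite_branching a).subset fun b hb => ?_
    obtain ⟨a, hab, hk⟩ := τ.exists_covBy_of_nodeLevel_eq_succ hb
    exact Set.mem_biUnion hk hab

theorem finite_level_lt (k : ℕ) : {a : T | nodeLevel a < k}.Finite :=
  ((Set.finite_Iio k).biUnion fun j _ => τ.finite_level j).subset fun _ ha =>
    Set.mem_biUnion ha rfl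

theorem map_eq_self_of_succOp {F : T → T} {n : ℕ} (hfix : ∀ a, nodeLevel a < n → F a = a)
    {a b : T} {p : List T} {e : A} (hp : τ.succOp a p e = some b) (ha : nodeLevel a ≤ n) :
    p.map F = p :=
  (List.map_congr_left fun q hq => hfix q (((τ.succ_spec _ _ _ _ hp).2 q hq).trans_le ha)).trans
    (List.map_id p)

namespace IsShapePreserving

variable {τ} {F : T → T} (hF : τ.IsShapePreserving F)

include hF

theorem nodeLevel_apply (a : T) : nodeLevel (F a) = levelMap F (nodeLevel a) := by
  have himage : (fun b => nodeLevel (F b)) '' {b | nodeLevel b = nodeLevel a} =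
      {nodeLevel (F a)} :=
    Set.Subset.antisymm (Set.image_subset_iff.2 fun b hb => hF.level_preserving b a hb)
      (Set.singleton_subset_iff.2 ⟨a, rfl, rfl⟩)
  rw [levelMap, himage, csInf_singleton]

theorem lt_of_covBy {a b : T} (h : a ⋖ b) : F a < F b := by
  obtain ⟨p, e, hp⟩ := τ.succ_constr a b h
  obtain ⟨d, hd, hdb⟩ := hF.weakly_succ_preserving _ _ _ _ hp
  exact (τ.succ_spec _ _ _ _ hd).1.lt.trans_le hdb

theorem mono {a b : T} (h : a ≤ b) : F a ≤ F b := by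
  induction hb : nodeLevel b, τ.nodeLevel_le h using Nat.le_induction generalizing b with
  | base => rw [τ.eq_of_le_of_nodeLevel_eq h hb.symm]
  | succ n hn ih =>
    obtain ⟨b', hb', rfl⟩ := τ.exists_covBy_of_nodeLevel_eq_succ hb
    exact (ih (τ.le_of_nodeLevel_le h hb'.le hn) rfl).trans (hF.lt_of_covBy hb').le

theorem succOp_apply {p : List T} {e : A} {a b : T} (hp : τ.succOp a p e = some b)
    (hl : nodeLevel (F b) = nodeLevel (F a) + 1) : τ.succOp (F a) (p.map F) e = some (F b) := by
  obtain ⟨d, hd, hdb⟩ := hF.weakly_succ_preserving _ _ _ _ hp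
  rw [hd, τ.eq_of_le_of_nodeLevel_eq hdb (by rw [hl, τ.nodeLevel_succOp hd])]

theorem exists_succOp_le {n : ℕ} (hfix : ∀ a, nodeLevel a < n → F a = a) {a b : T} {p : List T}
    {e : A} (hp : τ.succOp a p e = some b) (ha : nodeLevel a ≤ n) :
    ∃ d, τ.succOp (F a) p e = some d ∧ d ≤ F b := by
  have h := hF.weakly_succ_preserving _ _ _ _ hp
  rwa [τ.map_eq_self_of_succOp hfix hp ha] at h

theorem le_apply {n : ℕ} (hfix : ∀ a, nodeLevel a < n → F a = a) {a : T} (ha : nodeLevel a ≤ n) :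
    a ≤ F a := by
  rcases hk : nodeLevel a with _ | k
  · exact hF.root_le a a hk le_rfl
  · obtain ⟨a', ha', rfl⟩ := τ.exists_covBy_of_nodeLevel_eq_succ hk
    obtain ⟨p, e, hp⟩ := τ.succ_constr _ _ ha'
    obtain ⟨d, hd, hda⟩ := hF.exists_succOp_le hfix hp (by omega)
    rw [hfix a' (by omega), hp] at hd
    exact (Option.some.inj hd).trans_le hda

theorem apply_eq_self {n : ℕ} (h : ∀ a, nodeLevel a < n → nodeLevel (F a) = nodeLevel a) {a : T}
    (ha : nodeLevel a < n) : F a = a := by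
  induction hk : nodeLevel a using Nat.strong_induction_on generalizing a with
  | _ k ih =>
    have hfix : ∀ b, nodeLevel b < k → F b = b := fun b hb => ih _ hb (by omega) rfl
    exact (τ.eq_of_le_of_nodeLevel_eq (hF.le_apply hfix hk.le) (h a ha).symm).symm

end IsShapePreserving

end STree

namespace SMTree

variable (τ : SMTree T A)

include τ in
theorem exists_nodeLevel_eq (k : ℕ) : ∃ a : T, nodeLevel a = k := by
  obtain ⟨F, -, hskip, -⟩ := τ.duplication 0 (k + 1) k.succ_pos
  obtain ⟨a, ha⟩ : k ∈ Set.range fun a => nodeLevel (F a) := by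
    rw [hskip]; exact k.lt_succ_self.ne
  obtain ⟨b, -, hb⟩ := τ.exists_le_nodeLevel_eq (b := F a) ha.ge
  exact ⟨b, hb⟩

variable {τ} {F : T → T}

theorem mFix_anti : Antitone τ.MFix := fun _ _ hmn _ hF =>
  ⟨hF.1, fun a ha => hF.2 a (ha.trans_le hmn)⟩

theorem id_mem_mFix (n : ℕ) : id ∈ τ.MFix n := ⟨τ.id_mem, fun _ _ => rfl⟩

theorem comp_mem_mFix {n : ℕ} {G : T → T} (hF : F ∈ τ.MFix n) (hG : G ∈ τ.MFix n) :
    F ∘ G ∈ τ.MFix n :=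
  ⟨τ.comp_mem _ hF.1 _ hG.1, fun a ha => by rw [Function.comp_apply, hG.2 a ha, hF.2 a ha]⟩

theorem nodeLevel_apply (hF : F ∈ τ.M) (a : T) : nodeLevel (F a) = levelMap F (nodeLevel a) :=
  (τ.shape_preserving F hF).nodeLevel_apply a

theorem strictMono_levelMap (hF : F ∈ τ.M) : StrictMono (levelMap F) := by
  refine strictMono_nat_of_lt_succ fun k => ?_
  obtain ⟨b, hb⟩ := τ.exists_nodeLevel_eq (k + 1)
  obtain ⟨a, hab, rfl⟩ := τ.exists_covBy_of_nodeLevel_eq_succ hb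
  rw [← hb, ← nodeLevel_apply hF, ← nodeLevel_apply hF]
  exact τ.strictMono_nodeLevel ((τ.shape_preserving F hF).lt_of_covBy hab)

theorem range_levelMap (hF : F ∈ τ.M) :
    Set.range (levelMap F) = Set.range fun a => nodeLevel (F a) := by
  have hcomp : (fun a => nodeLevel (F a)) = levelMap F ∘ nodeLevel :=
    funext fun a => nodeLevel_apply hF a
  rw [hcomp, Set.range_comp, Set.range_eq_univ.2 τ.exists_nodeLevel_eq, Set.image_univ]

theorem levelMap_congr (hF : F ∈ τ.M) {G : T → T} (hG : G ∈ τ.M) {k : ℕ}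
    (h : ∀ a, nodeLevel a = k → F a = G a) : levelMap F k = levelMap G k := by
  obtain ⟨a, rfl⟩ := τ.exists_nodeLevel_eq k
  rw [← nodeLevel_apply hF, ← nodeLevel_apply hG, h a rfl]

theorem levelMap_comp (hF : F ∈ τ.M) {G : T → T} (hG : G ∈ τ.M) (k : ℕ) :
    levelMap (F ∘ G) k = levelMap F (levelMap G k) := by
  obtain ⟨a, rfl⟩ := τ.exists_nodeLevel_eq k
  rw [← nodeLevel_apply hG, ← nodeLevel_apply hF, ← nodeLevel_apply (τ.comp_mem _ hF _ hG),
    Function.comp_apply]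

theorem levelMap_of_skipsOnlyLevel (hF : F ∈ τ.M) {m : ℕ} (h : SkipsOnlyLevel F m) :
    levelMap F = fun k => if k < m then k else k + 1 := by
  have hmono : StrictMono fun k : ℕ => if k < m then k else k + 1 := by
    intro i j hij
    dsimp only
    split_ifs <;> omega
  rw [← (strictMono_levelMap hF).range_inj hmono, range_levelMap hF, h]
  ext k
  simp only [Set.mem_compl_iff, Set.mem_singleton_iff, Set.mem_range]
  constructor
  · intro hk
    rcases lt_or_gt_of_ne hk with hkm | hmk
    · exact ⟨k, if_pos hkm⟩
    · exact ⟨k - 1, by rw [if_neg (by omega)]; omega⟩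
  · rintro ⟨j, rfl⟩
    split_ifs <;> omega

theorem levelMap_of_skipsOnlyLevel_of_le (hF : F ∈ τ.M) {m k : ℕ} (h : SkipsOnlyLevel F m)
    (hk : m ≤ k) : levelMap F k = k + 1 := by
  rw [levelMap_of_skipsOnlyLevel hF h]
  exact if_neg hk.not_gt

theorem mem_mFix_of_skipsOnlyLevel (hF : F ∈ τ.M) {m : ℕ} (h : SkipsOnlyLevel F m) :
    F ∈ τ.MFix m :=
  ⟨hF, fun _ => (τ.shape_preserving F hF).apply_eq_self fun b hb => by
    rw [nodeLevel_apply hF, levelMap_of_skipsOnlyLevel hF h]; exact if_pos hb⟩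

theorem levelMap_of_mem_mFix {n k : ℕ} (hF : F ∈ τ.MFix n) (hk : k < n) : levelMap F k = k := by
  obtain ⟨a, rfl⟩ := τ.exists_nodeLevel_eq k
  rw [← nodeLevel_apply hF.1, hF.2 a hk]

theorem le_apply_of_mem_mFix {n : ℕ} (hF : F ∈ τ.MFix n) {a : T} (ha : nodeLevel a ≤ n) :
    a ≤ F a :=
  (τ.shape_preserving F hF.1).le_apply hF.2 ha

theorem exists_comp_of_skipped (hF : F ∈ τ.M) {n m : ℕ} (hm : levelMap F n = m + 1)
    (hs : ∀ k < n, levelMap F k < m) :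
    ∃ F₁ ∈ τ.M, ∃ F₂ ∈ τ.M, SkipsOnlyLevel F₂ m ∧ (∀ a, nodeLevel a ≤ n → F₂ (F₁ a) = F a) ∧
      levelMap F₁ n = m ∧ ∀ a, nodeLevel a < n → F₁ a = F a := by
  obtain ⟨r, rfl⟩ := τ.exists_nodeLevel_eq n
  have hskip : SkipsLevel F m := by
    rw [SkipsLevel, ← range_levelMap hF]
    rintro ⟨k, hk⟩
    rcases lt_or_ge k (nodeLevel r) with hkr | hkr
    · exact (hs k hkr).ne hk
    · have := (strictMono_levelMap hF).monotone hkr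
      omega
  obtain ⟨F₁, hF₁, F₂, hF₂, hsk, hcomp⟩ :=
    τ.decomposition F hF _ m ⟨r, rfl, (nodeLevel_apply hF r).trans hm⟩ hskip
  have hF₁r : levelMap F₁ (nodeLevel r) = m := by
    have h : levelMap F₂ (levelMap F₁ (nodeLevel r)) = m + 1 := by
      rw [← nodeLevel_apply hF₁, ← nodeLevel_apply hF₂, hcomp r le_rfl, nodeLevel_apply hF, hm]
    simp only [levelMap_of_skipsOnlyLevel hF₂ hsk] at h
    split_ifs at h <;> omega
  refine ⟨F₁, hF₁, F₂, hF₂, hsk, hcomp, hF₁r, fun a ha => ?_⟩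
  rw [← hcomp a ha.le, (mem_mFix_of_skipsOnlyLevel hF₂ hsk).2]
  rw [nodeLevel_apply hF₁, ← hF₁r]
  exact strictMono_levelMap hF₁ ha

theorem exists_levelMap_succ_eq (hF : F ∈ τ.M) (n : ℕ) :
    ∃ G ∈ τ.M, (∀ a, nodeLevel a ≤ n → G a = F a) ∧ levelMap G (n + 1) = levelMap F n + 1 := by
  have hlt := strictMono_levelMap hF n.lt_succ_self
  obtain ⟨i, hi⟩ := Nat.exists_eq_add_of_le (Nat.succ_le_of_lt hlt)
  induction i generalizing F with
  | zero => exact ⟨F, hF, fun _ _ => rfl, hi⟩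
  | succ i ih =>
    obtain ⟨F₁, hF₁, -, -, -, -, hlev, heq⟩ := exists_comp_of_skipped
      (m := levelMap F n + 1 + i) hF hi fun k hk => by
      have := (strictMono_levelMap hF).monotone (Nat.le_of_lt_succ hk)
      omega
    have hn : levelMap F₁ n = levelMap F n :=
      levelMap_congr hF₁ hF fun a ha => heq a (ha.trans_lt n.lt_succ_self)
    obtain ⟨G, hG, hGF₁, hGn⟩ := ih hF₁ (by omega) (by rw [hlev, hn])
    exact ⟨G, hG, fun a ha => by rw [hGF₁ a ha, heq a (by omega)], by rw [hGn, hn]⟩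

theorem exists_canonicalExtension (hF : F ∈ τ.M) (n : ℕ) :
    ∃ G ∈ τ.M, (∀ a, nodeLevel a ≤ n → G a = F a) ∧
      ∀ i, levelMap G (n + i) = levelMap F n + i := by
  choose g hgM hg hgs using fun (F : τ.M) (n : ℕ) => exists_levelMap_succ_eq F.2 n
  let H : ℕ → τ.M := fun i => Nat.rec ⟨F, hF⟩ (fun i F => ⟨g F (n + i), hgM F (n + i)⟩) i
  have hH : ∀ i j, i ≤ j → ∀ a, nodeLevel a ≤ n + i → (H j).1 a = (H i).1 a := by
    intro i j hij
    induction j, hij using Nat.le_induction with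
    | base => exact fun _ _ => rfl
    | succ j hj ih => exact fun a ha => (hg (H j) (n + j) a (by omega)).trans (ih a ha)
  have hlev : ∀ i, levelMap (H i).1 (n + i) = levelMap F n + i := by
    intro i
    induction i with
    | zero => rfl
    | succ i ih => exact (hgs (H i) (n + i)).trans (by rw [ih, add_assoc])
  obtain ⟨G, hG, hGH⟩ := τ.limit_mem (fun i => (H i).1) (fun i => (H i).2)
    fun i a ha => (hH i (i + 1) i.le_succ a (by omega)).symm
  have hGi : ∀ i a, nodeLevel a ≤ n + i → G a = (H i).1 a := fun i a ha =>
    (hGH (n + i) a ha).trans (hH i (n + i) (by omega) a ha)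
  exact ⟨G, hG, hGi 0, fun i =>
    (levelMap_congr hG (H i).2 fun a ha => hGi i a ha.le).trans (hlev i)⟩

theorem exists_mem_mFix_levelMap_eq {n N : ℕ} (hF : F ∈ τ.MFix n) (hnN : n ≤ N)
    (hN : N ≤ levelMap F n) :
    ∃ G ∈ τ.MFix n, levelMap G n = N ∧ ∀ a, nodeLevel a = n → G a ≤ F a := by
  obtain ⟨i, hi⟩ := Nat.exists_eq_add_of_le hN
  induction i generalizing F with
  | zero => exact ⟨F, hF, hi, fun _ _ => le_rfl⟩
  | succ i ih =>
    obtain ⟨F₁, hF₁, F₂, hF₂, hsk, hcomp, hlev, heq⟩ := exists_comp_of_skipped (m := N + i)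
      hF.1 hi fun k hk => by rw [levelMap_of_mem_mFix hF hk]; omega
    have hfix : F₁ ∈ τ.MFix n := ⟨hF₁, fun a ha => (heq a ha).trans (hF.2 a ha)⟩
    obtain ⟨G, hG, hGn, hle⟩ := ih hfix (by omega) hlev
    refine ⟨G, hG, hGn, fun a ha => (hle a ha).trans ?_⟩
    rw [← hcomp a ha.le]
    refine le_apply_of_mem_mFix (mem_mFix_of_skipsOnlyLevel hF₂ hsk) ?_
    rw [nodeLevel_apply hF₁, ha, hlev]

theorem restrictBelow_eq_iff {G : T → T} {k : ℕ} :
    restrictBelow F k = restrictBelow G k ↔ ∀ a, nodeLevel a < k → F a = G a := by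
  simp only [funext_iff, restrictBelow]
  refine forall_congr' fun a => ?_
  split_ifs with ha
  · simp only [ha, true_imp_iff, Option.some_inj]
  · simp only [ha, false_imp_iff]

section CanonicalExtension

variable (hF : F ∈ τ.M) (n : ℕ)

include hF

theorem isCanonicalExtension_canonicalExtension :
    τ.IsCanonicalExtension (restrictBelow F (n + 1)) n
      (τ.canonicalExtension (restrictBelow F (n + 1)) n) := by
  have hex : ∃ G, τ.IsCanonicalExtension (restrictBelow F (n + 1)) n G := by
    obtain ⟨G, hG, heq, hlev⟩ := exists_canonicalExtension hF n
    refine ⟨G, hG, restrictBelow_eq_iff.2 fun a ha => heq a (Nat.le_of_lt_succ ha), ?_⟩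
    rintro a k rfl hk
    rw [heq a le_rfl, nodeLevel_apply hF] at hk
    obtain ⟨i, rfl⟩ := Nat.exists_eq_add_of_le hk
    obtain ⟨b, hb⟩ := τ.exists_nodeLevel_eq (nodeLevel a + i)
    exact ⟨b, by rw [nodeLevel_apply hG, hb, hlev]⟩
  rw [canonicalExtension, dif_pos hex]
  exact hex.choose_spec

theorem canonicalExtension_mem : τ.canonicalExtension (restrictBelow F (n + 1)) n ∈ τ.M :=
  (isCanonicalExtension_canonicalExtension hF n).1

theorem canonicalExtension_apply {a : T} (ha : nodeLevel a ≤ n) :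
    τ.canonicalExtension (restrictBelow F (n + 1)) n a = F a :=
  restrictBelow_eq_iff.1 (isCanonicalExtension_canonicalExtension hF n).2.1 a (Nat.lt_succ_of_le ha)

theorem levelMap_canonicalExtension (i : ℕ) :
    levelMap (τ.canonicalExtension (restrictBelow F (n + 1)) n) (n + i) = levelMap F n + i := by
  set G := τ.canonicalExtension (restrictBelow F (n + 1)) n with hGdef
  have hG : G ∈ τ.M := canonicalExtension_mem hF n
  have hGn : levelMap G n = levelMap F n :=
    levelMap_congr hG hF fun a ha => canonicalExtension_apply hF n ha.le
  have hmono := strictMono_levelMap hG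
  induction i with
  | zero => exact hGn
  | succ i ih =>
    obtain ⟨a, ha⟩ := τ.exists_nodeLevel_eq n
    obtain ⟨b, hb⟩ := (isCanonicalExtension_canonicalExtension hF n).2.2 a (levelMap F n + i + 1)
      ha (by rw [← hGdef, nodeLevel_apply hG, ha, hGn]; omega)
    rw [← hGdef, nodeLevel_apply hG] at hb
    have hlt : n + i < nodeLevel b := hmono.lt_iff_lt.1 (by omega)
    have hle : levelMap G (n + (i + 1)) ≤ levelMap G (nodeLevel b) := hmono.monotone hlt
    have hsucc : levelMap G (n + i) < levelMap G (n + (i + 1)) := hmono (by omega)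
    omega

end CanonicalExtension

end SMTree

end Levels

/-! ### Steps of fat subtrees -/

section FatEdges

variable {T A : Type*} [PartialOrder T]

/-- The set of nodes of level `k`, written `T(k)` in the paper. -/
def levelSet (T : Type*) [PartialOrder T] (k : ℕ) : Set T := {a | nodeLevel a = k}

/-- The set of immediate successors of the nodes in `X`. -/
def succSet (X : Set T) : Set T := {b | ∃ a ∈ X, a ⋖ b}

theorem succSet_mono {X Y : Set T} (h : X ⊆ Y) : succSet X ⊆ succSet Y :=
  fun _ ⟨a, ha, hab⟩ => ⟨a, h ha, hab⟩

/-- One step of a fat subtree: a member of `AM^src_1(top)`. -/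
@[ext]
structure FatEdge (τ : SMTree T A) where
  src : ℕ
  top : ℕ
  val : T → Option T
  mem : val ∈ τ.AMApproxTo src 1 top

namespace FatEdge

variable {τ : SMTree T A} (e : FatEdge τ)

/-- The canonical extension of the partial function of a step. -/
noncomputable def extension : T → T := τ.canonicalExtension e.val e.src

/-- The value of the cut function that follows a step. -/
def tgt : ℕ := e.top + 1

theorem exists_mem_mFix_val_eq :
    ∃ F ∈ τ.MFix e.src, e.val = restrictBelow F (e.src + 1) ∧ levelMap F e.src = e.top := by
  obtain ⟨⟨F, hF, hval⟩, a, b, ha, hab, hb⟩ := e.mem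
  have ha' : nodeLevel a = e.src := Nat.succ_injective ha
  rw [hval, restrictBelow, if_pos (by omega)] at hab
  exact ⟨F, hF, hval, by rw [← ha', ← SMTree.nodeLevel_apply hF.1, Option.some.inj hab, hb]⟩

theorem extension_mem : e.extension ∈ τ.MFix e.src := by
  obtain ⟨F, hF, hval, -⟩ := e.exists_mem_mFix_val_eq
  rw [extension, hval]
  exact ⟨SMTree.canonicalExtension_mem hF.1 _, fun a ha =>
    (SMTree.canonicalExtension_apply hF.1 _ ha.le).trans (hF.2 a ha)⟩

theorem levelMap_extension (i : ℕ) : levelMap e.extension (e.src + i) = e.top + i := by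
  obtain ⟨F, hF, hval, htop⟩ := e.exists_mem_mFix_val_eq
  rw [extension, hval, SMTree.levelMap_canonicalExtension hF.1, htop]

theorem val_eq : e.val = restrictBelow e.extension (e.src + 1) := by
  obtain ⟨F, hF, hval, -⟩ := e.exists_mem_mFix_val_eq
  rw [extension, hval]
  exact (SMTree.isCanonicalExtension_canonicalExtension hF.1 _).2.1.symm

variable {e} in
theorem nodeLevel_extension {a : T} {i : ℕ} (h : nodeLevel a = e.src + i) :
    nodeLevel (e.extension a) = e.top + i := by
  rw [SMTree.nodeLevel_apply e.extension_mem.1, h, levelMap_extension]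

theorem src_le_top : e.src ≤ e.top :=
  (SMTree.strictMono_levelMap e.extension_mem.1).le_apply.trans_eq (e.levelMap_extension 0)

theorem src_lt_tgt : e.src < e.tgt := Nat.lt_succ_of_le e.src_le_top

variable {e}

theorem le_extension {a : T} (h : nodeLevel a = e.src) : a ≤ e.extension a :=
  SMTree.le_apply_of_mem_mFix e.extension_mem h.le

theorem succOp_extension {a b : T} {p : List T} {x : A} (h : nodeLevel a = e.src)
    (hp : τ.succOp a p x = some b) :
    τ.succOp (e.extension a) p x = some (e.extension b) := by
  have hb : nodeLevel b = e.src + 1 := by rw [τ.nodeLevel_succOp hp, h]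
  have hext := (τ.shape_preserving _ e.extension_mem.1).succOp_apply hp
    (by rw [nodeLevel_extension hb, nodeLevel_extension (i := 0) h])
  rwa [τ.map_eq_self_of_succOp e.extension_mem.2 hp h.le] at hext

theorem eq_of_extension {e' : FatEdge τ} (hs : e.src = e'.src)
    (h : ∀ a, nodeLevel a = e.src → e.extension a = e'.extension a) : e = e' := by
  have hval : e.val = e'.val := by
    rw [e.val_eq, e'.val_eq, ← hs, SMTree.restrictBelow_eq_iff]
    intro a ha
    rcases Nat.lt_succ_iff_lt_or_eq.1 ha with hlt | heq
    · rw [e.extension_mem.2 a hlt, e'.extension_mem.2 a (hlt.trans_eq hs)]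
    · exact h a heq
  have htop : e.top = e'.top := by
    refine (e.levelMap_extension 0).symm.trans (Eq.trans ?_ (e'.levelMap_extension 0))
    rw [← hs]
    exact SMTree.levelMap_congr e.extension_mem.1 e'.extension_mem.1 h
  exact FatEdge.ext hs htop hval

/-- The step from level `c` given by the restriction of a member of `τ.MFix c`. -/
noncomputable def ofFun {F : T → T} {c : ℕ} (hF : F ∈ τ.MFix c) : FatEdge τ where
  src := c
  top := levelMap F c
  val := restrictBelow F (c + 1)
  mem := by
    obtain ⟨a, rfl⟩ := τ.exists_nodeLevel_eq c
    exact ⟨⟨F, hF, rfl⟩, a, F a, rfl, if_pos (Nat.lt_succ_self _), SMTree.nodeLevel_apply hF.1 a⟩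

theorem ofFun_extension {F : T → T} {c : ℕ} {hF : F ∈ τ.MFix c} {a : T} (ha : nodeLevel a ≤ c) :
    (ofFun hF).extension a = F a :=
  SMTree.canonicalExtension_apply hF.1 c ha

variable (e) in
/-- The lift of a set of nodes of level `e.src` along a step, a set of nodes of level `e.tgt`. -/
noncomputable def lift (X : Set T) : Set T := e.extension '' succSet X

theorem lift_mono {X Y : Set T} (h : X ⊆ Y) : e.lift X ⊆ e.lift Y :=
  Set.image_mono (succSet_mono h)

theorem mem_lift_of_covBy {X : Set T} {a b : T} (ha : a ∈ X) (hab : a ⋖ b) :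
    e.extension b ∈ e.lift X :=
  ⟨b, ⟨a, ha, hab⟩, rfl⟩

theorem lift_subset_levelSet {X : Set T} (hX : X ⊆ levelSet T e.src) :
    e.lift X ⊆ levelSet T e.tgt := by
  rintro _ ⟨b, ⟨a, ha, hab⟩, rfl⟩
  exact nodeLevel_extension (by rw [τ.nodeLevel_covBy hab, hX ha])

theorem le_extension_of_covBy {a b : T} (h : nodeLevel a = e.src) (hab : a ⋖ b) :
    a ≤ e.extension b :=
  (le_extension h).trans ((τ.shape_preserving _ e.extension_mem.1).mono hab.le)

/-- The lift of a set of nodes along a sequence of steps. -/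
noncomputable def liftList (l : List (FatEdge τ)) (X : Set T) : Set T :=
  l.foldl (fun X e => e.lift X) X

theorem liftList_cons (e : FatEdge τ) (l : List (FatEdge τ)) (X : Set T) :
    liftList (e :: l) X = liftList l (e.lift X) := rfl

theorem liftList_append (l l' : List (FatEdge τ)) (X : Set T) :
    liftList (l ++ l') X = liftList l' (liftList l X) := List.foldl_append

theorem liftList_mono (l : List (FatEdge τ)) {X Y : Set T} (h : X ⊆ Y) :
    liftList l X ⊆ liftList l Y := by
  induction l generalizing X Y with
  | nil => exact h
  | cons _ _ ih => exact ih (lift_mono h)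

theorem liftList_subset_levelSet {l : List (FatEdge τ)} {m n : ℕ} (h : IsPathBetween src tgt m l n)
    {X : Set T} (hX : X ⊆ levelSet T m) : liftList l X ⊆ levelSet T n := by
  induction l generalizing m X with
  | nil => cases h; exact hX
  | cons e l ih =>
    obtain ⟨rfl, hl⟩ := h
    exact ih hl (lift_subset_levelSet hX)

theorem exists_mem_liftList_singleton {l : List (FatEdge τ)} {m n : ℕ}
    (h : IsPathBetween src tgt m l n) {X : Set T} (hX : X ⊆ levelSet T m) {y : T}
    (hy : y ∈ liftList l X) : ∃ a ∈ X, a ≤ y ∧ y ∈ liftList l {a} := by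
  induction l generalizing m X with
  | nil => exact ⟨y, hy, le_rfl, rfl⟩
  | cons e l ih =>
    obtain ⟨rfl, hl⟩ := h
    obtain ⟨_, ⟨b, ⟨a, ha, hab⟩, rfl⟩, hby, hya⟩ := ih hl (lift_subset_levelSet hX) hy
    exact ⟨a, ha, (le_extension_of_covBy (hX ha) hab).trans hby,
      liftList_mono l (Set.singleton_subset_iff.2
        (mem_lift_of_covBy (Set.mem_singleton a) hab)) hya⟩

theorem mem_liftList_of_le {l : List (FatEdge τ)} {m n : ℕ} (h : IsPathBetween src tgt m l n)
    {X : Set T} {a y : T} (haX : a ∈ X) (ham : nodeLevel a = m) (hay : a ≤ y)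
    (hy : y ∈ liftList l (levelSet T m)) : y ∈ liftList l X := by
  obtain ⟨b, hb, hby, hyb⟩ := exists_mem_liftList_singleton h subset_rfl hy
  obtain rfl : a = b := τ.eq_of_le_of_le hay hby (ham.trans hb.symm)
  exact liftList_mono l (Set.singleton_subset_iff.2 haX) hyb

/-- The step `e` is a step of a subtree of the finite fat subtree with steps `l`. -/
def Spanned (l : List (FatEdge τ)) (e : FatEdge τ) : Prop :=
  IsPathBetween src tgt e.src l e.tgt ∧
    e.lift (levelSet T e.src) ⊆ liftList l (levelSet T e.src)

theorem Spanned.subst {d : FatEdge τ} {l₁ l l₂ : List (FatEdge τ)}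
    (h : Spanned (l₁ ++ d :: l₂) e) (h' : Spanned l d) : Spanned (l₁ ++ l ++ l₂) e := by
  obtain ⟨k, hl₁, rfl, hl₂⟩ := isPathBetween_append.1 h.1
  refine ⟨isPathBetween_append.2 ⟨_, isPathBetween_append.2 ⟨_, hl₁, h'.1⟩, hl₂⟩, ?_⟩
  refine h.2.trans ?_
  rw [liftList_append, liftList_cons, liftList_append, liftList_append]
  refine liftList_mono _ ?_
  have hlevel : liftList l₁ (levelSet T e.src) ⊆ levelSet T d.src :=
    liftList_subset_levelSet hl₁ subset_rfl
  rintro _ ⟨b, ⟨a, ha, hab⟩, rfl⟩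
  exact mem_liftList_of_le h'.1 ha (hlevel ha) (le_extension_of_covBy (hlevel ha) hab)
    (h'.2 (mem_lift_of_covBy (hlevel ha) hab))

theorem finite_setOf_src_eq_tgt_eq (m n : ℕ) : {e : FatEdge τ | e.src = m ∧ e.tgt = n}.Finite := by
  have hdom : Finite {a : T // nodeLevel a = m} := τ.finite_level m
  have hcod : Finite {a : T // nodeLevel a < n} := τ.finite_level_lt n
  let f : {e : FatEdge τ | e.src = m ∧ e.tgt = n} →
      ({a : T // nodeLevel a = m} → {a : T // nodeLevel a < n}) := fun e a =>
    ⟨e.1.extension a.1, by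
      exact (nodeLevel_extension (i := 0) (a.2.trans e.2.1.symm)).trans_lt
        (Nat.lt_of_succ_le e.2.2.le)⟩
  refine Finite.of_injective f fun e e' h => Subtype.ext ?_
  refine eq_of_extension (e.2.1.trans e'.2.1.symm) fun a ha => ?_
  exact congrArg Subtype.val (congrFun h ⟨a, ha.trans e.2.1⟩)

end FatEdge

/-- The path system whose infinite paths are the infinite fat subtrees of an `(S, M)`-tree. -/
def SMTree.pathSystem (τ : SMTree T A) : PathSystem (FatEdge τ) where
  src := FatEdge.src
  tgt := FatEdge.tgt
  Spans := FatEdge.Spanned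
  src_lt_tgt := FatEdge.src_lt_tgt
  isPath_of_spans h := h.1
  spans_singleton _ := ⟨⟨rfl, rfl⟩, subset_rfl⟩
  spans_subst := FatEdge.Spanned.subst
  finite_edges := FatEdge.finite_setOf_src_eq_tgt_eq

end FatEdges

/-! ### Maps along the lifts of a fat subtree -/

section CopyingLevels

variable {T A : Type*} [PartialOrder T]

namespace STree

/-- The node of level `ℓ + 1` below `y` is obtained from its predecessor by means of the parameters
`p` and the letter `x`. -/
def LetterAt (τ : STree T A) (y : T) (ℓ : ℕ) (p : List T) (x : A) : Prop :=
  ∃ z d, nodeLevel z = ℓ ∧ τ.succOp z p x = some d ∧ d ≤ y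

theorem LetterAt.mono {τ : STree T A} {y y' : T} {ℓ : ℕ} {p : List T} {x : A}
    (h : τ.LetterAt y ℓ p x) (hy : y ≤ y') : τ.LetterAt y' ℓ p x :=
  let ⟨z, d, hz, hd, hdy⟩ := h
  ⟨z, d, hz, hd, hdy.trans hy⟩

theorem exists_letterAt (τ : STree T A) {y : T} {ℓ : ℕ} (h : ℓ < nodeLevel y) :
    ∃ p x, τ.LetterAt y ℓ p x := by
  obtain ⟨d, hdy, hd⟩ := τ.exists_le_nodeLevel_eq h
  obtain ⟨z, hzd, hz⟩ := τ.exists_covBy_of_nodeLevel_eq_succ hd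
  obtain ⟨p, x, hp⟩ := τ.succ_constr _ _ hzd
  exact ⟨p, x, z, d, hz, hp, hdy⟩

end STree

variable {τ : SMTree T A}

namespace SMTree

open Classical in
/-- A member of `M` that skips only level `m` and, on level `m`, copies the successors taken at
level `ℓ < m`. The junk value for `m ≤ ℓ` is the identity. -/
noncomputable def dup (τ : SMTree T A) (ℓ m : ℕ) : T → T :=
  if h : ℓ < m then (τ.duplication ℓ m h).choose else id

variable {ℓ m : ℕ}

theorem dup_mem (h : ℓ < m) : τ.dup ℓ m ∈ τ.M := by
  rw [dup, dif_pos h]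
  exact (τ.duplication ℓ m h).choose_spec.1

theorem skipsOnlyLevel_dup (h : ℓ < m) : SkipsOnlyLevel (τ.dup ℓ m) m := by
  rw [dup, dif_pos h]
  exact (τ.duplication ℓ m h).choose_spec.2.1

theorem succOp_dup (h : ℓ < m) {y : T} (hy : nodeLevel y = m) {p : List T} {x : A}
    (hl : τ.LetterAt y ℓ p x) : τ.succOp y p x = some (τ.dup ℓ m y) := by
  obtain ⟨z, d, hz, hd, hdy⟩ := hl
  rw [dup, dif_pos h]
  exact (τ.duplication ℓ m h).choose_spec.2.2 z y p x d hz hy hd hdy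

end SMTree

theorem FatEdge.dup_extension (e : FatEdge τ) {ℓ : ℕ} (h : ℓ < e.src) {z : T}
    (hz : nodeLevel z = e.src) :
    τ.dup ℓ e.top (e.extension z) = e.extension (τ.dup ℓ e.src z) := by
  obtain ⟨p, x, hp⟩ := τ.exists_letterAt (h.trans_eq hz.symm)
  have hsrc := succOp_extension hz (SMTree.succOp_dup h hz hp)
  have htop := SMTree.succOp_dup (h.trans_le e.src_le_top) (nodeLevel_extension (i := 0) hz)
    (hp.mono (le_extension hz))
  exact Option.some.inj (htop.symm.trans hsrc)

open PathSystem

namespace SMTree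

variable (U : τ.pathSystem.InfPath)

theorem src_succ (i : ℕ) : (U (i + 1)).src = (U i).top + 1 := U.src_succ i

theorem strictMono_src : StrictMono fun i => (U i).src := U.strictMono_src

/-- The lift in `U` of all nodes at the cut of index `i` to the cut of index `k`. -/
noncomputable def liftSeg (i k : ℕ) : Set T :=
  FatEdge.liftList (U.seg i k) (levelSet T (U i).src)

theorem liftSeg_self (i : ℕ) : liftSeg U i i = levelSet T (U i).src := by
  rw [liftSeg, InfPath.seg_self]; rfl

variable {U} {i j k : ℕ}

theorem liftSeg_succ (h : i ≤ k) : liftSeg U i (k + 1) = (U k).lift (liftSeg U i k) := by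
  rw [liftSeg, U.seg_succ h, FatEdge.liftList_append]; rfl

theorem liftSeg_eq_liftList (hij : i ≤ j) (hjk : j ≤ k) :
    liftSeg U i k = FatEdge.liftList (U.seg j k) (liftSeg U i j) := by
  rw [liftSeg, ← U.seg_append hij hjk, FatEdge.liftList_append, liftSeg]

theorem liftSeg_subset_levelSet (h : i ≤ k) : liftSeg U i k ⊆ levelSet T (U k).src :=
  FatEdge.liftList_subset_levelSet (U.isPath_seg h) subset_rfl

theorem mem_liftSeg_of_le (hij : i ≤ j) (hjk : j ≤ k) {a y : T} (ha : a ∈ liftSeg U i j)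
    (hay : a ≤ y) (hy : y ∈ liftSeg U j k) : y ∈ liftSeg U i k := by
  rw [liftSeg_eq_liftList hij hjk]
  exact FatEdge.mem_liftList_of_le (U.isPath_seg hjk) ha (liftSeg_subset_levelSet hij ha) hay hy

theorem exists_le_mem_liftSeg (hij : i ≤ j) (hjk : j ≤ k) {y : T} (hy : y ∈ liftSeg U i k) :
    ∃ a ∈ liftSeg U i j, a ≤ y := by
  rw [liftSeg_eq_liftList hij hjk] at hy
  obtain ⟨a, ha, hay, -⟩ := FatEdge.exists_mem_liftList_singleton (U.isPath_seg hjk)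
    (liftSeg_subset_levelSet hij) hy
  exact ⟨a, ha, hay⟩

theorem extension_le_of_mem_liftSeg (h : i < k) {a y : T} (ha : nodeLevel a = (U i).src)
    (hay : a ≤ y) (hy : y ∈ liftSeg U i k) : (U i).extension a ≤ y := by
  obtain ⟨z, hz, hzy⟩ := exists_le_mem_liftSeg i.le_succ h hy
  rw [liftSeg_succ le_rfl, liftSeg_self] at hz
  obtain ⟨b, ⟨a', ha', hab⟩, rfl⟩ := hz
  obtain rfl : a' = a := τ.eq_of_le_of_le ((FatEdge.le_extension_of_covBy ha' hab).trans hzy) hay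
    (ha'.trans ha.symm)
  exact ((τ.shape_preserving _ (U i).extension_mem.1).mono hab.le).trans hzy

variable (U i k) in
/-- The function `h` in `M` is the identity below the cut of index `i` in `U` and maps that cut
into its lift to the cut of index `k`. -/
structure IsLiftMap (h : T → T) : Prop where
  mem_mFix : h ∈ τ.MFix (U i).src
  mem_liftSeg : ∀ a, nodeLevel a = (U i).src → h a ∈ liftSeg U i k

namespace IsLiftMap

variable {g h : T → T}

theorem le_apply (hh : IsLiftMap U i k h) {a : T} (ha : nodeLevel a = (U i).src) : a ≤ h a :=
  le_apply_of_mem_mFix hh.mem_mFix ha.le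

theorem nodeLevel_apply (hh : IsLiftMap U i k h) (hik : i ≤ k) {a : T}
    (ha : nodeLevel a = (U i).src) : nodeLevel (h a) = (U k).src :=
  liftSeg_subset_levelSet hik (hh.mem_liftSeg a ha)

theorem levelMap_src (hh : IsLiftMap U i k h) (hik : i ≤ k) : levelMap h (U i).src = (U k).src := by
  obtain ⟨a, ha⟩ := τ.exists_nodeLevel_eq (U i).src
  rw [← ha, ← SMTree.nodeLevel_apply hh.mem_mFix.1, hh.nodeLevel_apply hik ha]

theorem id (U : τ.pathSystem.InfPath) (i : ℕ) : IsLiftMap U i i id :=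
  ⟨id_mem_mFix _, fun a ha => by rwa [liftSeg_self]⟩

theorem comp (hij : i ≤ j) (hjk : j ≤ k) (hg : IsLiftMap U j k g) (hh : IsLiftMap U i j h) :
    IsLiftMap U i k (g ∘ h) := by
  have hsrc : (U i).src ≤ (U j).src := (strictMono_src U).monotone hij
  refine ⟨comp_mem_mFix (mFix_anti hsrc hg.mem_mFix) hh.mem_mFix, fun a ha => ?_⟩
  have hha := hh.nodeLevel_apply hij ha
  exact mem_liftSeg_of_le hij hjk (hh.mem_liftSeg a ha) (hg.le_apply hha) (hg.mem_liftSeg _ hha)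

theorem extension_comp (U : τ.pathSystem.InfPath) (k : ℕ) {F : T → T} (hF : F ∈ τ.M)
    (hs : SkipsOnlyLevel F (U k).src) : IsLiftMap U k (k + 1) ((U k).extension ∘ F) := by
  have hfix := mem_mFix_of_skipsOnlyLevel hF hs
  refine ⟨comp_mem_mFix (U k).extension_mem hfix, fun a ha => ?_⟩
  rw [liftSeg_succ le_rfl, liftSeg_self]
  refine FatEdge.mem_lift_of_covBy ha (τ.covBy_of_le_of_nodeLevel_eq
    (le_apply_of_mem_mFix hfix ha.le) ?_)
  rw [SMTree.nodeLevel_apply hF, levelMap_of_skipsOnlyLevel_of_le hF hs ha.ge]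

theorem exists_le (hij : i ≤ j) (hjk : j ≤ k) (hh : IsLiftMap U i k h) :
    ∃ g, IsLiftMap U i j g ∧ ∀ a, nodeLevel a = (U i).src → g a ≤ h a := by
  have hmono := (strictMono_src U).monotone
  obtain ⟨g, hg, hlev, hle⟩ := exists_mem_mFix_levelMap_eq hh.mem_mFix (hmono hij)
    ((hmono hjk).trans_eq (hh.levelMap_src (hij.trans hjk)).symm)
  refine ⟨g, ⟨hg, fun a ha => ?_⟩, hle⟩
  obtain ⟨y, hy, hya⟩ := exists_le_mem_liftSeg hij hjk (hh.mem_liftSeg a ha)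
  rwa [τ.eq_of_le_of_le (hle a ha) hya]
  rw [SMTree.nodeLevel_apply hg.1, ha, hlev, liftSeg_subset_levelSet hij hy]

theorem exists_mem_span (hik : i ≤ k) (hh : IsLiftMap U i k h) :
    ∃ e ∈ U.span, e.src = (U i).src ∧ e.tgt = (U k).tgt ∧
      ∀ a, nodeLevel a = (U i).src → e.extension a = (U k).extension (h a) := by
  have hsrc : (U i).src ≤ (U k).src := (strictMono_src U).monotone hik
  let e : FatEdge τ := FatEdge.ofFun (c := (U i).src)
    (comp_mem_mFix (mFix_anti hsrc (U k).extension_mem) hh.mem_mFix)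
  have he : ∀ a, nodeLevel a = (U i).src → e.extension a = (U k).extension (h a) :=
    fun a ha => FatEdge.ofFun_extension ha.le
  have htop : e.top = (U k).top := by
    refine (levelMap_comp (U k).extension_mem.1 hh.mem_mFix.1 _).trans ?_
    rw [hh.levelMap_src hik]
    exact (U k).levelMap_extension 0
  have htgt : e.tgt = (U k).tgt := congrArg (· + 1) htop
  refine ⟨e, ⟨i, k + 1, ?_, ?_⟩, rfl, htgt, he⟩
  · rw [htgt]
    have hpath := U.isPath_seg (hik.trans k.le_succ)
    rwa [U.src_succ] at hpath
  · rintro _ ⟨b, ⟨a, ha, hab⟩, rfl⟩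
    change _ ∈ liftSeg U i (k + 1)
    obtain ⟨p, x, hp⟩ := τ.succ_constr _ _ hab
    obtain ⟨d, hd, -⟩ := (τ.shape_preserving _ hh.mem_mFix.1).exists_succOp_le hh.mem_mFix.2 hp
      (le_of_eq ha)
    have heb := FatEdge.succOp_extension ha hp
    rw [he a ha, FatEdge.succOp_extension (hh.nodeLevel_apply hik ha) hd] at heb
    rw [← Option.some.inj heb, liftSeg_succ hik]
    exact FatEdge.mem_lift_of_covBy (hh.mem_liftSeg a ha) (τ.succ_spec _ _ _ _ hd).1

end IsLiftMap

theorem exists_mem_liftSeg_extension_eq {e : FatEdge τ} (hik : i ≤ k)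
    (he : τ.pathSystem.Spans (U.seg i (k + 1)) e) {a : T} (ha : nodeLevel a = (U i).src) :
    ∃ y ∈ liftSeg U i k, e.extension a = (U k).extension y := by
  have hsrc : e.src = (U i).src := InfPath.src_eq_of_spans_seg he
  have htop : e.top = (U k).top := Nat.succ_injective
    ((InfPath.tgt_eq_of_spans_seg he).trans (U.src_succ k))
  have hae : nodeLevel a = e.src := ha.trans hsrc.symm
  have hlev : nodeLevel (e.extension a) = e.top := FatEdge.nodeLevel_extension (i := 0) hae
  rcases eq_or_lt_of_le (FatEdge.le_extension hae) with heq | hlt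
  · have htop' : (U k).top = (U i).src := by rw [← htop, ← hlev, ← heq, ha]
    obtain rfl : i = k := hik.antisymm ((strictMono_src U).le_iff_le.1
      ((U k).src_le_top.trans_eq htop'))
    refine ⟨a, by rwa [liftSeg_self], heq.symm.trans (τ.eq_of_le_of_nodeLevel_eq
      (FatEdge.le_extension ha) ?_)⟩
    rw [FatEdge.nodeLevel_extension (i := 0) ha, htop', ha, Nat.add_zero]
  · obtain ⟨b, hab, -⟩ := τ.exists_covBy_le_of_lt hlt
    have hmem : e.extension b ∈ liftSeg U i (k + 1) := by
      rw [liftSeg, ← hsrc]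
      exact he.2 (FatEdge.mem_lift_of_covBy hae hab)
    rw [liftSeg_succ hik] at hmem
    obtain ⟨b', ⟨y, hy, hyb⟩, hb'⟩ := hmem
    obtain ⟨p, x, hp⟩ := τ.succ_constr _ _ hab
    obtain ⟨p', x', hp'⟩ := τ.succ_constr _ _ hyb
    have hey := FatEdge.succOp_extension (liftSeg_subset_levelSet hik hy) hp'
    rw [hb'] at hey
    exact ⟨y, hy, (τ.succ_inj _ _ _ _ _ _ _ (FatEdge.succOp_extension hae hp) hey).1⟩

theorem exists_isLiftMap_of_mem_span {e : FatEdge τ} (he : e ∈ U.span) (hs : e.src = (U i).src) :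
    ∃ k h, i ≤ k ∧ IsLiftMap U i k h ∧
      ∀ a, nodeLevel a = (U i).src → e.extension a = (U k).extension (h a) := by
  obtain ⟨j, hsp⟩ := InfPath.exists_spans_seg_of_mem_span he hs
  obtain ⟨k, rfl⟩ := Nat.exists_eq_add_one_of_ne_zero (InfPath.lt_of_spans_seg hsp).ne_bot
  have hik : i ≤ k := Nat.le_of_lt_succ (InfPath.lt_of_spans_seg hsp)
  have htop : e.top = (U k).top := Nat.succ_injective
    ((InfPath.tgt_eq_of_spans_seg hsp).trans (U.src_succ k))
  have hmem : e.extension ∈ τ.MFix (U i).src := hs ▸ e.extension_mem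
  have hlev : levelMap e.extension (U i).src = (U k).top :=
    (hs ▸ e.levelMap_extension 0).trans htop
  obtain ⟨h, hh, hlev, hle⟩ := exists_mem_mFix_levelMap_eq hmem
    ((strictMono_src U).monotone hik) ((U k).src_le_top.trans_eq hlev.symm)
  have key : ∀ a, nodeLevel a = (U i).src →
      h a ∈ liftSeg U i k ∧ e.extension a = (U k).extension (h a) := by
    intro a ha
    obtain ⟨y, hy, hya⟩ := exists_mem_liftSeg_extension_eq hik hsp ha
    have hyl := liftSeg_subset_levelSet hik hy
    obtain rfl : h a = y := τ.eq_of_le_of_le (hle a ha)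
      ((FatEdge.le_extension hyl).trans_eq hya.symm)
      (by rw [SMTree.nodeLevel_apply hh.1, ha, hlev, hyl])
    exact ⟨hy, hya⟩
  exact ⟨k, h, hik, ⟨hh, fun a ha => (key a ha).1⟩, fun a ha => (key a ha).2⟩

end SMTree

end CopyingLevels

/-! ### The pigeonhole principle -/

section CopyWords

open PathSystem

variable {T A : Type*} [PartialOrder T] {τ : SMTree T A}

namespace SMTree

variable {U : τ.pathSystem.InfPath} {k m ℓ : ℕ}

/-- The map from the cut of index `k` in `U` to the next one that copies the successors taken at
level `ℓ`. If `ℓ` is not below the cut, then those taken at level `0` are copied instead. -/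
noncomputable def copyStep (U : τ.pathSystem.InfPath) (k ℓ : ℕ) : T → T :=
  (U k).extension ∘ τ.dup (if ℓ < (U k).src then ℓ else 0) (U k).src

theorem copyStep_of_lt (h : ℓ < (U k).src) (y : T) :
    copyStep U k ℓ y = (U k).extension (τ.dup ℓ (U k).src y) := by
  rw [copyStep, if_pos h]; rfl

theorem isLiftMap_copyStep (h : 0 < (U k).src) (ℓ : ℕ) :
    IsLiftMap U k (k + 1) (copyStep U k ℓ) := by
  have hlt : (if ℓ < (U k).src then ℓ else 0) < (U k).src := by split_ifs <;> assumption
  exact IsLiftMap.extension_comp U k (dup_mem hlt) (skipsOnlyLevel_dup hlt)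

theorem succOp_copyStep (h : ℓ < (U k).src) {y : T} (hy : nodeLevel y = (U k).src) {p : List T}
    {x : A} (hl : τ.LetterAt y ℓ p x) :
    τ.succOp ((U k).extension y) p x = some (copyStep U k ℓ y) := by
  rw [copyStep_of_lt h]
  exact FatEdge.succOp_extension hy (succOp_dup h hy hl)

/-- The composition of the copying steps given by a list of levels. -/
noncomputable def copyWord (U : τ.pathSystem.InfPath) : ℕ → List ℕ → T → T
  | _, [] => id
  | k, ℓ :: s => copyWord U (k + 1) s ∘ copyStep U k ℓ

theorem isLiftMap_copyWord (h : 0 < (U k).src) (s : List ℕ) :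
    IsLiftMap U k (k + s.length) (copyWord U k s) := by
  induction s generalizing k with
  | nil => exact IsLiftMap.id U k
  | cons ℓ s ih =>
    have htail := ih (h.trans (strictMono_src U k.lt_succ_self))
    have hword := htail.comp k.le_succ (Nat.le_add_right _ _) (isLiftMap_copyStep h ℓ)
    rwa [Nat.succ_add_eq_add_succ] at hword

/-- The action of the letters `ℓ : ℕ` on the maps into the cuts of `U`, each of which is given
together with the index of the cut. -/
noncomputable def copyAct (U : τ.pathSystem.InfPath) {ι : Type*} (x : ℕ × (ι → T)) (ℓ : ℕ) :
    ℕ × (ι → T) :=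
  (x.1 + 1, copyStep U x.1 ℓ ∘ x.2)

theorem foldl_copyAct {ι : Type*} (s : List ℕ) (k : ℕ) (w : ι → T) :
    s.foldl (copyAct U) (k, w) = (k + s.length, copyWord U k s ∘ w) := by
  induction s generalizing k w with
  | nil => rfl
  | cons ℓ s ih =>
    rw [List.foldl_cons, copyAct, ih, List.length_cons, Nat.succ_add_eq_add_succ]
    rfl

theorem copyWord_congr (z : List (Option ℕ)) {ℓ' : ℕ} {y : T} (hy : nodeLevel y = (U k).src)
    (hℓ : ℓ < (U k).src) (hℓ' : ℓ' < (U k).src) {p : List T} {x : A} (h : τ.LetterAt y ℓ p x)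
    (h' : τ.LetterAt y ℓ' p x) :
    copyWord U k (z.map (·.getD ℓ)) y = copyWord U k (z.map (·.getD ℓ')) y := by
  induction z generalizing k y with
  | nil => rfl
  | cons o z ih =>
    have hstep : copyStep U k (o.getD ℓ) y = copyStep U k (o.getD ℓ') y := by
      cases o with
      | some a => rfl
      | none =>
        exact Option.some.inj ((succOp_copyStep hℓ hy h).symm.trans (succOp_copyStep hℓ' hy h'))
    have hlift := isLiftMap_copyStep (hℓ.pos) (o.getD ℓ')
    have hlt := strictMono_src U k.lt_succ_self
    change copyWord U (k + 1) _ (copyStep U k _ y) = copyWord U (k + 1) _ (copyStep U k _ y)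
    rw [hstep]
    exact ih (hlift.nodeLevel_apply k.le_succ hy) (hℓ.trans hlt) (hℓ'.trans hlt)
      (h.mono (hlift.le_apply hy)) (h'.mono (hlift.le_apply hy))

/-- Once the letter at level `ℓ` has been copied to the level below the next cut, copying from the
latter level amounts to copying from level `ℓ`. -/
theorem copyWord_copyStep (z : List (Option ℕ)) (hℓ : ℓ < (U k).src) {y : T}
    (hy : nodeLevel y = (U k).src) :
    copyWord U (k + 1) (z.map (·.getD (U k).top)) (copyStep U k ℓ y) =
      copyWord U (k + 1) (z.map (·.getD ℓ)) (copyStep U k ℓ y) := by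
  obtain ⟨p, x, hp⟩ := τ.exists_letterAt (hℓ.trans_eq hy.symm)
  have hlift := isLiftMap_copyStep hℓ.pos ℓ
  refine copyWord_congr z (hlift.nodeLevel_apply k.le_succ hy) ?_
    (hℓ.trans (strictMono_src U k.lt_succ_self))
    ⟨_, _, FatEdge.nodeLevel_extension (i := 0) hy, succOp_copyStep hℓ hy hp, le_rfl⟩
    (hp.mono (hlift.le_apply hy))
  rw [src_succ]
  exact Nat.lt_succ_self _

theorem succOp_apply_of_skipsOnlyLevel {F : T → T} (hF : F ∈ τ.M) (hs : SkipsOnlyLevel F m)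
    {a b : T} (ha : nodeLevel a = m) {p : List T} {x : A} (hp : τ.succOp a p x = some b) :
    τ.succOp (F a) p x = some (F b) := by
  have hlev : nodeLevel (F b) = nodeLevel (F a) + 1 := by
    rw [nodeLevel_apply hF, nodeLevel_apply hF, τ.nodeLevel_succOp hp, ha,
      levelMap_of_skipsOnlyLevel_of_le hF hs le_rfl,
      levelMap_of_skipsOnlyLevel_of_le hF hs m.le_succ]
  have hFp := (τ.shape_preserving F hF).succOp_apply hp hlev
  rwa [τ.map_eq_self_of_succOp (mem_mFix_of_skipsOnlyLevel hF hs).2 hp ha.le] at hFp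

theorem exists_skipsOnlyLevel_succ {G X : T → T} (hG : G ∈ τ.M) (hGm : SkipsOnlyLevel G m)
    (hX : X ∈ τ.M) (hXm : SkipsOnlyLevel X m) :
    ∃ F ∈ τ.M, SkipsOnlyLevel F (m + 1) ∧ ∀ a, nodeLevel a = m → F (X a) = X (G a) := by
  have hGlev := levelMap_of_skipsOnlyLevel hG hGm
  have hXlev := levelMap_of_skipsOnlyLevel hX hXm
  obtain ⟨F₁, hF₁, F, hF, hFm, hcomp, hlev, -⟩ := exists_comp_of_skipped (τ.comp_mem _ hX _ hG)
    (n := m) (m := m + 1) (by simp [levelMap_comp hX hG, hGlev, hXlev])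
    (fun k hk => by
      simp only [levelMap_comp hX hG, hGlev, hXlev, if_pos hk]
      exact hk.trans m.lt_succ_self)
  refine ⟨F, hF, hFm, fun a ha => ?_⟩
  have hF₁a : nodeLevel (F₁ a) = m + 1 := by rw [nodeLevel_apply hF₁, ha, hlev]
  have hle : F₁ a ≤ X (G a) := (le_apply_of_mem_mFix (mem_mFix_of_skipsOnlyLevel hF hFm)
    hF₁a.le).trans_eq (hcomp a ha.le)
  have hXle : X a ≤ X (G a) := (τ.shape_preserving X hX).mono
    (le_apply_of_mem_mFix (mem_mFix_of_skipsOnlyLevel hG hGm) ha.le)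
  have heq : F₁ a = X a := τ.eq_of_le_of_le hle hXle
    (by rw [hF₁a, nodeLevel_apply hX, ha, levelMap_of_skipsOnlyLevel_of_le hX hXm le_rfl])
  rw [← heq]
  exact hcomp a ha.le

end SMTree

namespace FatEdge

/-- The sets of successors of nodes of the source level whose letters occur along the edge,
simultaneously at a single level. -/
def occurring (e : FatEdge τ) : Set (Set T) :=
  {B | B ⊆ levelSet T (e.src + 1) ∧ ∃ ℓ < e.top, ∀ b ∈ B, ∀ a p x, τ.succOp a p x = some b →
    τ.LetterAt (e.extension a) ℓ p x}

end FatEdge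

namespace SMTree

variable {U : τ.pathSystem.InfPath} {k j : ℕ}

/-- No edge spanned by `U` that starts at the cut of index `k` has more occurring sets of successors
than the edge of index `k` itself. -/
def IsRich (U : τ.pathSystem.InfPath) (k : ℕ) : Prop :=
  ∀ e ∈ U.span, e.src = (U k).src → e.occurring ⊆ (U k).occurring

theorem extension_le_of_mem_span {e : FatEdge τ} (he : e ∈ U.span) (hs : e.src = (U k).src) {a : T}
    (ha : nodeLevel a = (U k).src) : (U k).extension a ≤ e.extension a := by
  obtain ⟨j, h, hkj, hh, heq⟩ := exists_isLiftMap_of_mem_span he hs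
  rw [heq a ha]
  rcases hkj.eq_or_lt with rfl | hlt
  · rw [← τ.eq_of_le_of_nodeLevel_eq (hh.le_apply ha) (by rw [hh.nodeLevel_apply le_rfl ha, ha])]
  · exact (extension_le_of_mem_liftSeg hlt ha (hh.le_apply ha) (hh.mem_liftSeg a ha)).trans
      (FatEdge.le_extension (hh.nodeLevel_apply hkj ha))

theorem occurring_subset_of_mem_span {e : FatEdge τ} (he : e ∈ U.span) (hs : e.src = (U k).src) :
    (U k).occurring ⊆ e.occurring := by
  rintro B ⟨hB, ℓ, hℓ, hBℓ⟩
  have hle {a : T} (ha : nodeLevel a = (U k).src) := extension_le_of_mem_span he hs ha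
  have htop : (U k).top ≤ e.top := by
    obtain ⟨a, ha⟩ := τ.exists_nodeLevel_eq (U k).src
    have hlev := τ.nodeLevel_le (hle ha)
    rwa [FatEdge.nodeLevel_extension (i := 0) ha,
      FatEdge.nodeLevel_extension (i := 0) (ha.trans hs.symm)] at hlev
  refine ⟨hs ▸ hB, ℓ, hℓ.trans_le htop, fun b hb a p x hp => (hBℓ b hb a p x hp).mono (hle ?_)⟩
  exact Nat.succ_injective ((τ.nodeLevel_succOp hp).symm.trans (hB hb))

theorem exists_mem_cone_forall_isRich (U : τ.pathSystem.InfPath) (n : ℕ) :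
    ∃ V ∈ U.cone n, ∀ i ≥ n, IsRich V i := by
  have hmax : ∀ k, ∃ e, MaximalFor (· ∈ {e ∈ U.span | e.src = (U k).src}) FatEdge.occurring e :=
    fun k => Set.Finite.exists_maximalFor' _ _
      ((τ.finite_level ((U k).src + 1)).finite_subsets.finite_subsets.subset (by
        rintro _ ⟨e, ⟨-, hs⟩, rfl⟩ B hB
        exact hs ▸ hB.1)) ⟨U k, InfPath.mem_span_self U k, rfl⟩
  have htgt : ∀ e ∈ U.span, ∃ j, e.tgt = (U j).src :=
    fun e ⟨_, j, hsp⟩ => ⟨j, InfPath.tgt_eq_of_spans_seg hsp⟩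
  choose e he hemax using hmax
  choose next hnext using fun k => htgt (e k) (he k).1
  let K : ℕ → ℕ := Nat.rec n fun _ => next
  obtain ⟨V, hV, hVe⟩ := InfPath.exists_mem_cone_apply_add (s := e ∘ K) (he n).2
    (fun i => (he (K (i + 1))).2.trans (hnext (K i)).symm) fun i => (he (K i)).1
  refine ⟨V, hV, fun i hi e' he' hs => ?_⟩
  obtain ⟨i, rfl⟩ := Nat.exists_eq_add_of_le hi
  have hocc := occurring_subset_of_mem_span he' hs
  rw [hVe] at hocc hs ⊢
  exact hemax (K i) ⟨InfPath.span_mono hV.1 he', hs.trans (he (K i)).2⟩ hocc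

/-- The set of successors of nodes on the cut of index `k` that is chosen by `G` above the image of
`h` is made to occur along an edge by performing `G` one level higher, after a copying step. -/
theorem IsLiftMap.exists_mem_occurring {h G : T → T} (hkj : k < j) (hh : IsLiftMap U k j h)
    (hG : G ∈ τ.M) (hGs : SkipsOnlyLevel G (U j).top) :
    ∃ v ∈ U.span, v.src = (U k).src ∧ {b | ∃ y p x, nodeLevel y = (U k).src ∧
      τ.succOp y p x = some b ∧ τ.succOp ((U j).extension (h y)) p x =
        some (G ((U j).extension (h y)))} ∈ v.occurring := by
  have hj : 0 < (U j).src := (strictMono_src U hkj).pos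
  have htop : 0 < (U j).top := hj.trans_le (U j).src_le_top
  have hX := dup_mem (τ := τ) htop
  have hXs := skipsOnlyLevel_dup (τ := τ) htop
  obtain ⟨F, hF, hFs, hFX⟩ := exists_skipsOnlyLevel_succ hG hGs hX hXs
  rw [← src_succ] at hFs
  let H : T → T := copyStep U j 0 ∘ h
  have hH : IsLiftMap U k (j + 1) H := (isLiftMap_copyStep hj 0).comp hkj.le j.le_succ hh
  have hFH := (IsLiftMap.extension_comp U (j + 1) hF hFs).comp (hkj.le.trans j.le_succ)
    (j + 1).le_succ hH
  obtain ⟨v, hv, hvs, hvt, hve⟩ := hFH.exists_mem_span (by omega)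
  refine ⟨v, hv, hvs, ?_, (U (j + 1)).top, ?_, ?_⟩
  · rintro b ⟨y, p, x, hy, hp, -⟩
    exact (τ.nodeLevel_succOp hp).trans (by rw [hy, hvs])
  · have hlt := (U (j + 1 + 1)).src_lt_tgt
    rw [← hvt, src_succ] at hlt
    exact Nat.lt_of_succ_lt_succ hlt
  · rintro b ⟨y, p', x', hy, hp', hGp⟩ a p x hp
    obtain ⟨rfl, rfl, rfl⟩ := τ.succ_inj _ _ _ _ _ _ _ hp hp'
    have hha := hh.nodeLevel_apply hkj.le hy
    have hea : nodeLevel ((U j).extension (h a)) = (U j).top :=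
      FatEdge.nodeLevel_extension (i := 0) hha
    have hHa := hH.nodeLevel_apply (hkj.le.trans j.le_succ) hy
    have hHX : H a = τ.dup 0 (U j).top ((U j).extension (h a)) :=
      (copyStep_of_lt hj _).trans ((U j).dup_extension hj hha).symm
    have hstep : τ.succOp (H a) p x = some (F (H a)) := by
      rw [hHX, hFX _ hea]
      exact succOp_apply_of_skipsOnlyLevel hX hXs hea hGp
    refine ⟨_, _, FatEdge.nodeLevel_extension (i := 0) hHa, FatEdge.succOp_extension hHa hstep, ?_⟩
    rw [hve a hy]
    exact FatEdge.le_extension (hFH.nodeLevel_apply (by omega) hy)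

/-- In a rich path, every simultaneous choice of successors that is available to a subtree is a copy
of the choice at an earlier level. -/
theorem IsRich.exists_eq_copyStep (hR : IsRich U k) {h G : T → T} (hkj : k < j)
    (hh : IsLiftMap U k j h) (hG : G ∈ τ.M) (hGs : SkipsOnlyLevel G (U j).top) :
    ∃ ℓ < (U k).top, ∀ y p x b, nodeLevel y = (U k).src → τ.succOp y p x = some b →
      τ.succOp ((U j).extension (h y)) p x = some (G ((U j).extension (h y))) →
        G ((U j).extension (h y)) = copyStep U j ℓ (h y) := by
  obtain ⟨v, hv, hvs, hB⟩ := hh.exists_mem_occurring hkj hG hGs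
  obtain ⟨-, ℓ, hℓ, hBℓ⟩ := hR v hv hvs hB
  refine ⟨ℓ, hℓ, fun y p x b hy hp hGp => ?_⟩
  have hletter : τ.LetterAt (h y) ℓ p x := (hBℓ b ⟨y, p, x, hy, hp, hGp⟩ y p x hp).mono
    (extension_le_of_mem_liftSeg hkj hy (hh.le_apply hy) (hh.mem_liftSeg y hy))
  have hℓj : ℓ < (U j).src := hℓ.trans (Nat.lt_of_succ_le
    ((src_succ U k).symm.trans_le ((strictMono_src U).monotone hkj)))
  exact Option.some.inj
    (hGp.symm.trans (succOp_copyStep hℓj (hh.nodeLevel_apply hkj.le hy) hletter))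

end SMTree

end CopyWords

section Homogeneous

open PathSystem

variable {T A : Type*} [PartialOrder T] {τ : SMTree T A}

namespace SMTree

variable {U V : τ.pathSystem.InfPath} {k j m n : ℕ} {B h : T → T}

theorem IsLiftMap.exists_succOp_extension (hnm : n ≤ m) (hh : IsLiftMap V n (m + 1) h) :
    ∃ g, IsLiftMap V n m g ∧ ∃ F ∈ τ.M, SkipsOnlyLevel F (V m).top ∧
      ∀ a, nodeLevel a = (V n).src → F ((V m).extension (g a)) = h a ∧
        ∃ p x b, τ.succOp (g a) p x = some b ∧
          τ.succOp ((V m).extension (g a)) p x = some (h a) := by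
  have hlev := (hh.levelMap_src (hnm.trans m.le_succ)).trans (src_succ V m)
  obtain ⟨F₁, hF₁, F, hF, hFs, hcomp, hF₁lev, -⟩ := exists_comp_of_skipped hh.mem_mFix.1 hlev
    fun i hi => (levelMap_of_mem_mFix hh.mem_mFix hi).trans_lt
      (hi.trans_le (((strictMono_src V).monotone hnm).trans (V m).src_le_top))
  obtain ⟨g, hg, hgh⟩ := hh.exists_le hnm m.le_succ
  refine ⟨g, hg, F, hF, hFs, fun a ha => ?_⟩
  have hga := hg.nodeLevel_apply hnm ha
  have hmem := hh.mem_liftSeg a ha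
  rw [liftSeg_succ hnm] at hmem
  obtain ⟨b, ⟨y, hy, hyb⟩, hb⟩ := hmem
  have hyl := liftSeg_subset_levelSet hnm hy
  have hyh : (V m).extension y ≤ h a :=
    ((τ.shape_preserving _ (V m).extension_mem.1).mono hyb.le).trans_eq hb
  obtain rfl : g a = y := τ.eq_of_le_of_le (hgh a ha) ((FatEdge.le_extension hyl).trans hyh)
    (hga.trans hyl.symm)
  obtain ⟨p, x, hp⟩ := τ.succ_constr _ _ hyb
  have hF₁a : nodeLevel (F₁ a) = (V m).top := by rw [SMTree.nodeLevel_apply hF₁, ha, hF₁lev]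
  have hF₁h : F₁ a ≤ h a :=
    (le_apply_of_mem_mFix (mem_mFix_of_skipsOnlyLevel hF hFs) hF₁a.le).trans_eq (hcomp a ha.le)
  have heq : (V m).extension (g a) = F₁ a := τ.eq_of_le_of_le hyh hF₁h
    ((FatEdge.nodeLevel_extension (i := 0) hga).trans hF₁a.symm)
  exact ⟨heq ▸ hcomp a ha.le, p, x, b, hp, hb ▸ FatEdge.succOp_extension hga hp⟩

theorem IsRich.exists_eq_copyStep_comp (hR : IsRich U k) (hkj : k < j) (hB : IsLiftMap U k j B)
    (hsrc : (V m).src = (U k).src) (htgt : (V m).tgt = (U j).tgt)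
    (hV : ∀ y, nodeLevel y = (U k).src → (V m).extension y = (U j).extension (B y))
    (hnm : n ≤ m) (hh : IsLiftMap V n (m + 1) h) :
    ∃ g, IsLiftMap V n m g ∧ ∃ ℓ < (U k).top, ∀ a, nodeLevel a = (V n).src →
      h a = copyStep U j ℓ (B (g a)) := by
  obtain ⟨g, hg, F, hF, hFs, hgF⟩ := hh.exists_succOp_extension hnm
  rw [Nat.succ_injective htgt] at hFs
  obtain ⟨ℓ, hℓ, hcopy⟩ := hR.exists_eq_copyStep hkj hB hF hFs
  refine ⟨g, hg, ℓ, hℓ, fun a ha => ?_⟩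
  have hga : nodeLevel (g a) = (U k).src := (hg.nodeLevel_apply hnm ha).trans hsrc
  obtain ⟨hFg, p, x, b, hp, hpx⟩ := hgF a ha
  rw [hV _ hga] at hFg hpx
  exact hFg ▸ hcopy (g a) p x b hga hp (hFg.symm ▸ hpx)

/-- A stage in the construction of a homogeneous subtree. The cut of index `idx` in `U` has been
reached, `maps` contains the maps from the cut of index `n` along the part built so far, and
`next`, which leads to the cut of index `reach`, is the beginning of the next edge. -/
structure HomogeneousStage (U : τ.pathSystem.InfPath) (n : ℕ)
    (G : Set (ℕ × (levelSet T (U n).src → T))) where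
  idx : ℕ
  reach : ℕ
  next : T → T
  maps : Set (levelSet T (U n).src → T)
  le_idx : n ≤ idx
  idx_le : idx ≤ reach
  pos : 0 < (U reach).src
  isLiftMap : IsLiftMap U idx reach next
  finite : maps.Finite
  nodeLevel_eq : ∀ w ∈ maps, ∀ a, nodeLevel (w a) = (U idx).src
  mem : ∀ w ∈ maps, (reach, next ∘ w) ∈ G

namespace HomogeneousStage

variable {G E : Set (ℕ × (levelSet T (U n).src → T))}

/-- The stage at which the cut of index `n` itself has been reached. -/
def initial (hh : IsLiftMap U n (n + 1) h)
    (hG : (n + 1, fun a : levelSet T (U n).src => h a) ∈ G) :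
    HomogeneousStage U n G where
  idx := n
  reach := n + 1
  next := h
  maps := {Subtype.val}
  le_idx := le_rfl
  idx_le := n.le_succ
  pos := (strictMono_src U n.lt_succ_self).pos
  isLiftMap := hh
  finite := Set.finite_singleton _
  nodeLevel_eq := by rintro _ rfl a; exact a.2
  mem := by rintro _ rfl; exact hG

theorem exists_extension_word (hG : IsRecurrent (copyAct U) G E) (s : HomogeneousStage U n G) :
    ∃ (j : ℕ) (B : T → T) (z : List ℕ), s.idx < j ∧ 0 < (U j).src ∧ IsLiftMap U s.idx j B ∧
      ∀ w ∈ s.maps, (j, B ∘ w) ∈ E ∧ ∀ ℓ < (U s.idx).top,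
        (j + 1 + z.length, copyWord U (j + 1) z ∘ copyStep U j ℓ ∘ B ∘ w) ∈ G := by
  obtain ⟨t, z, ht, htz⟩ := hG ((fun w => (s.reach, s.next ∘ w)) '' s.maps) (s.finite.image _)
    (Set.image_subset_iff.2 s.mem) (Finset.range (U s.idx).top)
  have hreach : s.reach ≤ s.reach + t.length := Nat.le_add_right _ _
  have hidx : s.idx < s.reach + t.length :=
    s.idx_le.trans_lt (Nat.lt_add_of_pos_right (List.length_pos_iff.2 ht))
  have hmono := (strictMono_src U).monotone
  have hB : IsLiftMap U s.idx (s.reach + t.length) (copyWord U s.reach t ∘ s.next) :=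
    (isLiftMap_copyWord s.pos t).comp s.idx_le hreach s.isLiftMap
  have htop : (U s.idx).top < (U (s.reach + t.length)).src :=
    Nat.lt_of_succ_le ((src_succ U s.idx).symm.trans_le (hmono hidx))
  refine ⟨_, _, z.map (·.getD (U (s.reach + t.length)).top), hidx, s.pos.trans_le (hmono hreach),
    hB, fun w hw => ?_⟩
  obtain ⟨hE, hfG⟩ := htz _ ⟨w, hw, rfl⟩
  simp only [List.foldl_append, List.foldl_cons, foldl_copyAct] at hE hfG
  refine ⟨hE, fun ℓ hℓ => ?_⟩
  have hG' := hfG ℓ (Finset.mem_range.2 hℓ)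
  simp only [copyAct, foldl_copyAct, List.length_map] at hG'
  rw [List.length_map]
  convert hG' using 2
  exact funext fun a => copyWord_copyStep z (hℓ.trans htop)
    (hB.nodeLevel_apply hidx.le (s.nodeLevel_eq w hw a))

theorem exists_next (hG : IsRecurrent (copyAct U) G E) (s : HomogeneousStage U n G) :
    ∃ (s' : HomogeneousStage U n G) (j : ℕ) (B : T → T), s.idx < j ∧ IsLiftMap U s.idx j B ∧
      s'.idx = j + 1 ∧ ∀ w ∈ s.maps, (j, B ∘ w) ∈ E ∧
        ∀ ℓ < (U s.idx).top, copyStep U j ℓ ∘ B ∘ w ∈ s'.maps := by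
  obtain ⟨j, B, z, hidx, hj, hB, hmem⟩ := s.exists_extension_word hG
  refine ⟨{
    idx := j + 1
    reach := j + 1 + z.length
    next := copyWord U (j + 1) z
    maps := Set.image2 (fun w ℓ => copyStep U j ℓ ∘ B ∘ w) s.maps (Set.Iio (U s.idx).top)
    le_idx := s.le_idx.trans (hidx.le.trans j.le_succ)
    idx_le := Nat.le_add_right _ _
    pos := hj.trans_le ((strictMono_src U).monotone (by omega))
    isLiftMap := isLiftMap_copyWord (hj.trans (strictMono_src U j.lt_succ_self)) z
    finite := s.finite.image2 _ (Set.finite_Iio _)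
    nodeLevel_eq := ?_
    mem := ?_ }, j, B, hidx, hB, rfl, fun w hw => ⟨(hmem w hw).1, fun ℓ hℓ => ⟨w, hw, ℓ, hℓ, rfl⟩⟩⟩
  · rintro _ ⟨w, hw, ℓ, -, rfl⟩ a
    exact (isLiftMap_copyStep hj ℓ).nodeLevel_apply j.le_succ
      (hB.nodeLevel_apply hidx.le (s.nodeLevel_eq w hw a))
  · rintro _ ⟨w, hw, ℓ, hℓ, rfl⟩
    exact (hmem w hw).2 ℓ hℓ

end HomogeneousStage

theorem exists_mem_cone_forall_isLiftMap (hR : ∀ i ≥ n, IsRich U i)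
    {G E : Set (ℕ × (levelSet T (U n).src → T))} (hG : IsRecurrent (copyAct U) G E)
    (hh : IsLiftMap U n (n + 1) h) (h₀ : (n + 1, fun a : levelSet T (U n).src => h a) ∈ G) :
    ∃ V ∈ U.cone n, ∀ i g, IsLiftMap V n (n + i) g → ∃ x ∈ E, ∀ a : levelSet T (U n).src,
      (V (n + i)).extension (g a) = (U x.1).extension (x.2 a) := by
  choose next J B hJ hB hnext hnextE using HomogeneousStage.exists_next hG
  let S : ℕ → HomogeneousStage U n G := Nat.rec (.initial hh h₀) fun _ => next
  choose e heU hes het hee using fun i => (hB (S i)).exists_mem_span (hJ (S i)).le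
  obtain ⟨V, hV, hVe⟩ := InfPath.exists_mem_cone_apply_add (d := n) (s := e) (hes 0)
    (fun i => (hes (i + 1)).trans ((congrArg (fun k => (U k).src) (hnext (S i))).trans
      ((U.src_succ _).trans (het i).symm))) heU
  have hVn : (V n).src = (U n).src := InfPath.src_eq_of_mem_cone hV
  have hmaps : ∀ i g, IsLiftMap V n (n + i) g →
      (fun a : levelSet T (U n).src => g a) ∈ (S i).maps := by
    intro i
    induction i with
    | zero =>
      intro g hg
      change _ = _
      funext a
      have ha : nodeLevel a.1 = (V n).src := a.2.trans hVn.symm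
      exact (τ.eq_of_le_of_nodeLevel_eq (hg.le_apply ha)
        (ha.trans (hg.nodeLevel_apply le_rfl ha).symm)).symm
    | succ i ih =>
      intro f hf
      obtain ⟨g, hg, ℓ, hℓ, hfg⟩ := (hR _ (S i).le_idx).exists_eq_copyStep_comp (hJ (S i))
        (hB (S i)) ((hVe i).symm ▸ hes i) ((hVe i).symm ▸ het i) ((hVe i).symm ▸ hee i)
        (Nat.le_add_right n i) hf
      have heq : (fun a : levelSet T (U n).src => f a) =
          copyStep U (J (S i)) ℓ ∘ B (S i) ∘ fun a : levelSet T (U n).src => g a :=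
        funext fun a => hfg a (a.2.trans hVn.symm)
      rw [heq]
      exact (hnextE (S i) _ (ih g hg)).2 ℓ hℓ
  refine ⟨V, hV, fun i g hg => ⟨_, (hnextE (S i) _ (hmaps i g hg)).1, fun a => ?_⟩⟩
  rw [hVe]
  refine hee i _ ?_
  rw [hg.nodeLevel_apply (Nat.le_add_right n i) (a.2.trans hVn.symm), hVe, hes]

theorem eq_of_mem_span_of_forall_not_isLiftMap (hU : ∀ h, ¬ IsLiftMap U n (n + 1) h)
    {e : FatEdge τ} (he : e ∈ U.span) (hs : e.src = (U n).src) : e = U n := by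
  obtain ⟨k, h, hnk, hh, heq⟩ := exists_isLiftMap_of_mem_span he hs
  obtain rfl : n = k := by
    by_contra hne
    obtain ⟨g, hg, -⟩ := hh.exists_le n.le_succ (hnk.lt_of_ne hne)
    exact hU g hg
  refine FatEdge.eq_of_extension hs fun a ha => ?_
  have han := ha.trans hs
  rw [heq a han, ← τ.eq_of_le_of_nodeLevel_eq (hh.le_apply han)
    (han.trans (hh.nodeLevel_apply le_rfl han).symm)]

theorem exists_homogeneous_of_isRich (hR : ∀ i ≥ n, IsRich U i) (O : Set (FatEdge τ)) :
    ∃ V ∈ U.cone n, (∀ e ∈ V.span, e.src = (U n).src → e ∈ O) ∨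
      ∀ e ∈ V.span, e.src = (U n).src → e ∉ O := by
  by_cases hne : ∀ h, ¬ IsLiftMap U n (n + 1) h
  · refine ⟨U, InfPath.self_mem_cone U n, (em (U n ∈ O)).imp (fun hO e he hs => ?_)
      fun hO e he hs => ?_⟩ <;> rwa [eq_of_mem_span_of_forall_not_isLiftMap hne he hs]
  push Not at hne
  obtain ⟨h, hh⟩ := hne
  let E : Set (ℕ × (levelSet T (U n).src → T)) :=
    {x | ∃ e ∈ O, e.src = (U n).src ∧
      ∀ a : levelSet T (U n).src, e.extension a = (U x.1).extension (x.2 a)}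
  obtain ⟨G, E', hE', h₀, hG⟩ := exists_isRecurrent (copyAct U) E (n + 1, fun a => h a)
  obtain ⟨V, hV, hVE⟩ := exists_mem_cone_forall_isLiftMap hR hG hh h₀
  have hcol : ∀ e ∈ V.span, e.src = (U n).src → ∃ x ∈ E', ∀ a : levelSet T (U n).src,
      e.extension a = (U x.1).extension (x.2 a) := by
    intro e he hs
    have hVn : (V n).src = (U n).src := InfPath.src_eq_of_mem_cone hV
    obtain ⟨k, g, hnk, hg, heq⟩ := exists_isLiftMap_of_mem_span he (hs.trans hVn.symm)
    obtain ⟨i, rfl⟩ := Nat.exists_eq_add_of_le hnk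
    obtain ⟨x, hx, hgx⟩ := hVE i g hg
    exact ⟨x, hx, fun a => (heq a (a.2.trans hVn.symm)).trans (hgx a)⟩
  refine ⟨V, hV, hE'.imp ?_ ?_⟩
  · rintro rfl e he hs
    obtain ⟨x, ⟨d, hd, hds, hdx⟩, hx⟩ := hcol e he hs
    rwa [FatEdge.eq_of_extension (hs.trans hds.symm) fun a ha =>
      (hx ⟨a, ha.trans hs⟩).trans (hdx ⟨a, ha.trans hs⟩).symm]
  · rintro rfl e he hs hO
    obtain ⟨x, hxE, hx⟩ := hcol e he hs
    exact hxE ⟨e, hO, hs, hx⟩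

theorem pigeonhole (τ : SMTree T A) : τ.pathSystem.Pigeonhole := by
  intro U n O
  obtain ⟨V, hV, hR⟩ := exists_mem_cone_forall_isRich U n
  obtain ⟨W, hW, hWO⟩ := exists_homogeneous_of_isRich hR O
  have hVn : (V n).src = (U n).src := InfPath.src_eq_of_mem_cone hV
  rw [hVn] at hWO
  exact ⟨W, InfPath.mem_cone_trans hV hW le_rfl, hWO⟩

end SMTree

end Homogeneous

/-! ### Fat subtrees as infinite paths -/

section FatSubtrees

open PathSystem

theorem HasBaireProperty.preimage {X Y : Type*} [TopologicalSpace X] [TopologicalSpace Y]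
    {f : X → Y} {s : Set Y} (hs : HasBaireProperty s) (hf : Continuous f) (hf' : IsOpenMap f) :
    HasBaireProperty (f ⁻¹' s) := by
  obtain ⟨O, N, hO, hN, rfl⟩ := hs
  exact ⟨f ⁻¹' O, f ⁻¹' N, hO.preimage hf, hN.preimage_of_isOpenMap hf hf', rfl⟩

namespace SMTree.FatSubtree

variable {T A : Type*} [PartialOrder T] {τ : SMTree T A} {U V : τ.FatSubtree ⊤}
  {X : Set (τ.FatSubtree ⊤)} {d i j k n : ℕ} {x : τ.FatSubtree k}

theorem isCut_cut {h : ℕ∞} (U : τ.FatSubtree h) : τ.IsCut h U.seq U.cut := U.exists_cut.choose_spec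

theorem lift_succ_self {h : ℕ∞} (U : τ.FatSubtree h) (i : ℕ) : U.lift i (i + 1) =
    τ.canonicalExtension (U.seq i) (U.cut i) '' succSet (levelSet T (U.cut i)) := by
  rw [lift, Nat.add_sub_cancel_left]
  rfl

theorem cut_succ_sub_add (U : τ.FatSubtree ⊤) (i : ℕ) : U.cut (i + 1) - 1 + 1 = U.cut (i + 1) := by
  obtain ⟨m, hm, -⟩ := U.isCut_cut.2 i (ENat.natCast_lt_top i)
  rw [hm, Nat.add_sub_cancel]

/-- An infinite fat subtree as an infinite path of the path system of `τ`. -/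
noncomputable def toPath (U : τ.FatSubtree ⊤) : τ.pathSystem.InfPath where
  edge i :=
    { src := U.cut i
      top := U.cut (i + 1) - 1
      val := U.seq i
      mem := by
        obtain ⟨m, hm, h⟩ := U.isCut_cut.2 i (ENat.natCast_lt_top i)
        rwa [hm, Nat.add_sub_cancel] }
  src_zero := U.isCut_cut.1
  src_succ i := (U.cut_succ_sub_add i).symm

theorem isCut_of_infPath (W : τ.pathSystem.InfPath) :
    τ.IsCut ⊤ (fun i => (W i).val) fun i => (W i).src :=
  ⟨W.src_zero, fun i _ => ⟨(W i).top, src_succ W i, (W i).mem⟩⟩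

/-- The infinite fat subtree that consists of the partial functions of an infinite path. -/
def ofPath (W : τ.pathSystem.InfPath) : τ.FatSubtree ⊤ where
  seq i := (W i).val
  seq_padding i hi := absurd hi (not_le.2 (ENat.natCast_lt_top i))
  exists_cut := ⟨_, isCut_of_infPath W⟩

theorem cut_ofPath (W : τ.pathSystem.InfPath) (i : ℕ) : (ofPath W).cut i = (W i).src :=
  (ofPath W).isCut_cut.unique (isCut_of_infPath W) i le_top

theorem toPath_ofPath (W : τ.pathSystem.InfPath) : (ofPath W).toPath = W := by
  refine InfPath.ext (funext fun i => FatEdge.ext (cut_ofPath W i) ?_ rfl)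
  change (ofPath W).cut (i + 1) - 1 = _
  rw [cut_ofPath, src_succ, Nat.add_sub_cancel]

theorem liftSteps_eq (U : τ.FatSubtree ⊤) (j i : ℕ) (Y : Set T) :
    U.liftSteps j i Y = FatEdge.liftList (U.toPath.seg i (i + j)) Y := by
  induction j generalizing i Y with
  | zero => rw [Nat.add_zero, InfPath.seg_self]; rfl
  | succ j ih =>
    rw [InfPath.seg_eq_cons _ (Nat.lt_add_of_pos_right j.succ_pos), FatEdge.liftList_cons,
      liftSteps, ih, add_right_comm, add_assoc]
    rfl

theorem lift_eq (U : τ.FatSubtree ⊤) (h : i ≤ k) :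
    U.lift i k = FatEdge.liftList (U.toPath.seg i k) (levelSet T (U.cut i)) := by
  rw [lift, liftSteps_eq, Nat.add_sub_cancel' h, levelSet]

theorem tgt_toPath (U : τ.FatSubtree ⊤) (i : ℕ) :
    τ.pathSystem.tgt (U.toPath i) = U.cut (i + 1) :=
  U.cut_succ_sub_add i

theorem spans_seg_toPath_iff (hjk : j ≤ k) (hj : V.cut i = U.cut j)
    (hk : V.cut (i + 1) = U.cut k) :
    τ.pathSystem.Spans (U.toPath.seg j k) (V.toPath i) ↔ V.lift i (i + 1) ⊆ U.lift j k := by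
  have hpath : τ.pathSystem.IsPath (V.cut i) (U.toPath.seg j k)
      (τ.pathSystem.tgt (V.toPath i)) := by
    rw [tgt_toPath, hj, hk]
    exact U.toPath.isPath_seg hjk
  have hlift : U.lift j k = FatEdge.liftList (U.toPath.seg j k) (levelSet T (V.cut i)) :=
    hj ▸ U.lift_eq hjk
  rw [hlift, lift_succ_self]
  exact and_iff_right hpath

theorem isSubtree_iff : V.IsSubtree U ↔ V.toPath ≤ U.toPath := by
  constructor
  · rintro ⟨φ, -, h⟩ i
    obtain ⟨hi, hle, hlift⟩ := h i (ENat.natCast_lt_top i)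
    have hi' := (h (i + 1) (ENat.natCast_lt_top (i + 1))).1
    exact ⟨φ i, φ (i + 1), (spans_seg_toPath_iff hle hi hi').2 hlift⟩
  · intro h
    choose φ ψ hspan using h
    have hφ (i) : V.cut i = U.cut (φ i) := InfPath.src_eq_of_spans_seg (hspan i)
    have hψ (i) : ψ i = φ (i + 1) := U.toPath.strictMono_src.injective <|
      (InfPath.tgt_eq_of_spans_seg (hspan i)).symm.trans ((V.tgt_toPath i).trans (hφ (i + 1)))
    refine ⟨φ, fun _ _ => le_top, fun i _ => ?_⟩
    have hi := hψ i ▸ hspan i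
    have hle := (InfPath.lt_of_spans_seg hi).le
    exact ⟨hφ i, hle, (spans_seg_toPath_iff hle (hφ i) (hφ (i + 1))).1 hi⟩

theorem cut_eq_of_seq_eq (h : ∀ i < k, U.seq i = x.seq i) (hi : i ≤ k) : U.cut i = x.cut i := by
  have hc : τ.IsCut k x.seq U.cut := ⟨U.isCut_cut.1, fun i hi => by
    rw [← h i (by exact_mod_cast hi)]
    exact U.isCut_cut.2 i (ENat.natCast_lt_top i)⟩
  exact hc.unique x.isCut_cut i (by exact_mod_cast hi)

theorem toPath_apply_eq_iff {C : τ.FatSubtree ⊤} (hC : ∀ i < k, C.seq i = x.seq i) :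
    (∀ i < k, U.toPath i = C.toPath i) ↔ ∀ i < k, U.seq i = x.seq i := by
  refine ⟨fun h i hi => (congrArg FatEdge.val (h i hi)).trans (hC i hi), fun h i hi => ?_⟩
  have hcut {j} (hj : j ≤ k) : U.cut j = C.cut j :=
    (cut_eq_of_seq_eq h hj).trans (cut_eq_of_seq_eq hC hj).symm
  exact FatEdge.ext (hcut hi.le) (congrArg (· - 1) (hcut hi)) ((h i hi).trans (hC i hi).symm)

theorem basic_eq_preimage_cylinder {C : τ.FatSubtree ⊤} (hC : ∀ i < k, C.seq i = x.seq i)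
    (U : τ.FatSubtree ⊤) :
    basic x U = toPath ⁻¹' InfPath.cylinder (C.toPath.seg 0 k) U.toPath :=
  Set.ext fun _ => (and_congr isSubtree_iff (toPath_apply_eq_iff hC).symm).trans
    InfPath.mem_cylinder_seg.symm

theorem seq_truncate (U : τ.FatSubtree ⊤) (hi : i < n) : (U.truncate n).seq i = U.seq i :=
  if_pos hi

theorem continuous_toPath : Continuous (toPath (τ := τ)) := by
  refine continuous_generateFrom_iff.2 ?_
  rintro _ ⟨y, W, rfl⟩
  rcases (toPath ⁻¹' InfPath.cylinder y W).eq_empty_or_nonempty with h | ⟨C, -, hC⟩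
  · exact h ▸ isOpen_empty
  · refine TopologicalSpace.isOpen_generateFrom_of_mem
      ⟨y.length, C.truncate y.length, ofPath W, ?_⟩
    rw [basic_eq_preimage_cylinder fun i hi => (C.seq_truncate hi).symm, hC, toPath_ofPath]

theorem continuous_ofPath : Continuous (ofPath (τ := τ)) := by
  refine continuous_generateFrom_iff.2 ?_
  rintro _ ⟨k, x, U, rfl⟩
  rcases (basic x U).eq_empty_or_nonempty with h | ⟨C, -, hC⟩
  · rw [h]
    exact isOpen_empty
  · rw [basic_eq_preimage_cylinder hC, ← Set.preimage_comp,
      show toPath ∘ ofPath = id from funext toPath_ofPath]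
    exact InfPath.isOpen_cylinder _ _

/-- The space of infinite fat subtrees is homeomorphic to the space of infinite paths. -/
noncomputable def pathHomeomorph : τ.FatSubtree ⊤ ≃ₜ τ.pathSystem.InfPath where
  toFun := toPath
  invFun := ofPath
  left_inv _ := rfl
  right_inv := toPath_ofPath
  continuous_toFun := continuous_toPath
  continuous_invFun := continuous_ofPath

theorem IsSubtree.of_seq_eq {C : τ.FatSubtree ⊤} (h : C.IsSubtree U)
    (hC : ∀ i < k, C.seq i = x.seq i) : x.IsSubtree U := by
  obtain ⟨φ, -, hφ⟩ := h
  refine ⟨φ, fun _ _ => le_top, fun i hi => ?_⟩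
  have hik : i < k := by exact_mod_cast hi
  obtain ⟨hcut, hle, hlift⟩ := hφ i (ENat.natCast_lt_top i)
  rw [lift_succ_self, hC i hik, cut_eq_of_seq_eq hC hik.le, ← lift_succ_self] at hlift
  exact ⟨(cut_eq_of_seq_eq hC hik.le).symm.trans hcut, hle, hlift⟩

theorem depth_eq (hx : x.IsSubtree U) (hd : U.cut d = x.cut k) : depth U x = d := by
  refine le_antisymm (sInf_le ⟨hx, d, rfl, hd⟩) (le_sInf ?_)
  rintro _ ⟨-, n, rfl, hn⟩
  rw [U.toPath.strictMono_src.injective (hn.trans hd.symm)]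

theorem exists_depth_eq_of_basic_nonempty (h : (basic x U).Nonempty) :
    ∃ (d : ℕ) (y : List (FatEdge τ)), depth U x = d ∧ U.toPath.HasDepth y d ∧
      ∀ V, basic x V = toPath ⁻¹' InfPath.cylinder y V.toPath := by
  obtain ⟨C, hCU, hC⟩ := h
  obtain ⟨d, hd, hdC⟩ := InfPath.exists_hasDepth (C.toPath.isPath_seg_zero k)
    fun _ => InfPath.mem_span_of_mem_seg (isSubtree_iff.1 hCU)
  exact ⟨d, C.toPath.seg 0 k,
    depth_eq (hCU.of_seq_eq hC) (hdC.trans (cut_eq_of_seq_eq hC le_rfl)), hd,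
    basic_eq_preimage_cylinder hC⟩

theorem ofPath_mem_basic_truncate {W : τ.pathSystem.InfPath} (hW : W ∈ U.toPath.cone d) :
    ofPath W ∈ basic (U.truncate d) U :=
  ⟨isSubtree_iff.2 ((toPath_ofPath W).symm ▸ hW.1),
    fun i hi => (congrArg FatEdge.val (hW.2 i hi)).trans (U.seq_truncate hi).symm⟩

theorem isRamsey_of_isRamsey_preimage (hX : InfPath.IsRamsey (ofPath ⁻¹' X)) : IsRamsey X := by
  intro k x U hne
  obtain ⟨d, y, hd, hy, hb⟩ := exists_depth_eq_of_basic_nonempty hne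
  obtain ⟨W, hW, h⟩ := hX U.toPath d y hy
  refine ⟨d, hd, ofPath W, ofPath_mem_basic_truncate hW, ?_⟩
  rw [hb, toPath_ofPath]
  exact h.imp (fun h B hB => h hB) fun h => (h.preimage toPath).inter_eq

theorem isRamseyNull_of_isRamseyNull_preimage (hX : InfPath.IsRamseyNull (ofPath ⁻¹' X)) :
    IsRamseyNull X := by
  intro k x U hne
  obtain ⟨d, y, hd, hy, hb⟩ := exists_depth_eq_of_basic_nonempty hne
  obtain ⟨W, hW, h⟩ := hX U.toPath d y hy
  refine ⟨d, hd, ofPath W, ofPath_mem_basic_truncate hW, ?_⟩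
  rw [hb, toPath_ofPath]
  exact (h.preimage toPath).inter_eq

theorem isRamsey_of_hasBaireProperty (hX : HasBaireProperty X) : IsRamsey X :=
  isRamsey_of_isRamsey_preimage <| InfPath.isRamsey_of_hasBaireProperty τ.pigeonhole <|
    hX.preimage pathHomeomorph.symm.continuous pathHomeomorph.symm.isOpenMap

theorem isRamseyNull_of_isMeagre (hX : IsMeagre X) : IsRamseyNull X :=
  isRamseyNull_of_isRamseyNull_preimage <| InfPath.isRamseyNull_of_isMeagre τ.pigeonhole <|
    hX.preimage_of_isOpenMap pathHomeomorph.symm.continuous pathHomeomorph.symm.isOpenMap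

end SMTree.FatSubtree

end FatSubtrees

theorem theorem1p10 {T A : Type*} [PartialOrder T] (τ : SMTree T A) :
    (∀ X : Set (τ.FatSubtree ⊤), HasBaireProperty X → SMTree.FatSubtree.IsRamsey X) ∧
      (∀ X : Set (τ.FatSubtree ⊤), IsMeagre X → SMTree.FatSubtree.IsRamseyNull X) :=
  ⟨fun _ hX => SMTree.FatSubtree.isRamsey_of_hasBaireProperty hX,
    fun _ hX => SMTree.FatSubtree.isRamseyNull_of_isMeagre hX⟩
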